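/- Let $k$ be an algebraically closed field of characteristic $0$, let $C$ be a smooth irreducible projective curve over $k$, let $E$ be a vector bundle of rank $2$ on $C$, and let $\pi\colon X=\mathbb{P}_C(E)=\mathrm{Proj}(\mathrm{Sym}\,E)\to C$ be the associated ruled surface. Write $\Omega^1_C=\Omega^1_{C/k}$ and $\Omega^1_X=\Omega^1_{X/k}$ for the sheaves of Kähler differentials, and let $\eta\colon\Omega^1_C\to\pi_*(\Omega^1_X)$ be the natural map, that is, the $\mathcal{O}_C$-linear map with $\eta(df)=d(\pi^{\#}f)$ for every local section $f$ of $\mathcal{O}_C$ (the adjoint of the pullback of differentials $\pi^*\Omega^1_C\to\Omega^1_X$). Then $\eta$ is an isomorphism of $\mathcal{O}_C$-modules. -/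

import Mathlib

open CategoryTheory Limits AlgebraicGeometry TopologicalSpace

universe u

namespace RuledSurface

noncomputable section

/-! ### The grading of the symmetric algebra -/

section Sym

variable (R M : Type u) [CommRing R] [AddCommGroup M] [Module R M]

/-- The degree `n` part `Symⁿ M` of the symmetric algebra: the span of the `n`-fold products of
elements of `M`. -/
def symGrading (n : ℕ) : Submodule R (SymmetricAlgebra R M) :=
  (LinearMap.range (SymmetricAlgebra.ι R M)) ^ n

instance : SetLike.GradedMonoid (symGrading R M) :=
  Submodule.nat_power_gradedMonoid (LinearMap.range (SymmetricAlgebra.ι R M))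

variable {R M} in
lemma ι_mem_symGrading (m : M) : SymmetricAlgebra.ι R M m ∈ symGrading R M 1 := by
  rw [symGrading, pow_one]; exact LinearMap.mem_range_self _ m

/-- The inclusion of `M` into the direct sum of the graded pieces of its symmetric algebra. -/
def symGradedι : M →ₗ[R] DirectSum ℕ fun i => symGrading R M i :=
  DirectSum.lof R ℕ (fun i => symGrading R M i) 1 ∘ₗ
    (SymmetricAlgebra.ι R M).codRestrict _ ι_mem_symGrading

lemma symGradedι_apply (m : M) : symGradedι R M m =
    DirectSum.of (fun i => symGrading R M i) 1 ⟨SymmetricAlgebra.ι R M m, ι_mem_symGrading m⟩ :=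
  rfl

lemma lift_symGradedι_eq (i : ℕ) (x : symGrading R M i) :
    SymmetricAlgebra.lift (symGradedι R M) x = DirectSum.of (fun i => symGrading R M i) i x := by
  obtain ⟨x, hx⟩ := x
  dsimp only
  induction hx using Submodule.pow_induction_on_left' with
  | algebraMap r => rw [AlgHom.commutes, DirectSum.algebraMap_apply]; rfl
  | add x y i hx hy ihx ihy =>
    rw [map_add, ihx, ihy, ← map_add]
    rfl
  | mem_mul m hm i x hx ih =>
    obtain ⟨_, rfl⟩ := hm
    rw [map_mul, ih, SymmetricAlgebra.lift_ι_apply, symGradedι_apply, DirectSum.of_mul_of]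
    exact DirectSum.of_eq_of_gradedMonoid_eq (Sigma.subtype_ext (add_comm _ _) rfl)

instance : GradedAlgebra (symGrading R M) :=
  GradedAlgebra.ofAlgHom _ (SymmetricAlgebra.lift (symGradedι R M))
    (by
      refine SymmetricAlgebra.algHom_ext (LinearMap.ext fun m => ?_)
      change DirectSum.coeAlgHom (symGrading R M)
        (SymmetricAlgebra.lift (symGradedι R M) (SymmetricAlgebra.ι R M m)) =
          SymmetricAlgebra.ι R M m
      rw [SymmetricAlgebra.lift_ι_apply, symGradedι_apply, DirectSum.coeAlgHom_of])
    (lift_symGradedι_eq R M)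

end Sym

section SymMap

variable {R S : Type u} [CommRing R] [CommRing S] {M N : Type u} [AddCommGroup M] [Module R M]
  [AddCommGroup N] [Module S N]

lemma sym_ringHom_ext {A : Type*} [CommRing A] {φ ψ : SymmetricAlgebra R M →+* A}
    (h₁ : ∀ r, φ (algebraMap R _ r) = ψ (algebraMap R _ r))
    (h₂ : ∀ m, φ (SymmetricAlgebra.ι R M m) = ψ (SymmetricAlgebra.ι R M m)) : φ = ψ := by
  refine RingHom.ext fun a => ?_
  induction a using SymmetricAlgebra.induction with
  | algebraMap r => exact h₁ r
  | ι x => exact h₂ x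
  | mul a b ha hb => rw [map_mul, map_mul, ha, hb]
  | add a b ha hb => rw [map_add, map_add, ha, hb]

variable (σ : R →+* S) (f : M →ₛₗ[σ] N)

/-- The ring homomorphism `Sym_R M → Sym_S N` induced by a semilinear map `M → N`. -/
def symMapRingHom : SymmetricAlgebra R M →+* SymmetricAlgebra S N :=
  letI : Algebra R (SymmetricAlgebra S N) :=
    ((algebraMap S (SymmetricAlgebra S N)).comp σ).toAlgebra
  (SymmetricAlgebra.lift (R := R) (M := M) (A := SymmetricAlgebra S N)
    { toFun := fun m => SymmetricAlgebra.ι S N (f m)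
      map_add' := fun x y => by simp
      map_smul' := fun r x => by
        rw [map_smulₛₗ, map_smul, Algebra.smul_def]
        rfl }).toRingHom

@[simp] lemma symMapRingHom_algebraMap (r : R) :
    symMapRingHom σ f (algebraMap R _ r) = algebraMap S _ (σ r) := by
  let _ : Algebra R (SymmetricAlgebra S N) :=
    ((algebraMap S (SymmetricAlgebra S N)).comp σ).toAlgebra
  exact AlgHom.commutes (SymmetricAlgebra.lift (R := R) (M := M) (A := SymmetricAlgebra S N) _) r

@[simp] lemma symMapRingHom_ι (m : M) :
    symMapRingHom σ f (SymmetricAlgebra.ι R M m) = SymmetricAlgebra.ι S N (f m) := by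
  let _ : Algebra R (SymmetricAlgebra S N) :=
    ((algebraMap S (SymmetricAlgebra S N)).comp σ).toAlgebra
  exact SymmetricAlgebra.lift_ι_apply (R := R) (M := M) (A := SymmetricAlgebra S N) _ m

lemma symMapRingHom_mem {n : ℕ} {x : SymmetricAlgebra R M} (hx : x ∈ symGrading R M n) :
    symMapRingHom σ f x ∈ symGrading S N n := by
  induction hx using Submodule.pow_induction_on_left' with
  | algebraMap r => 
    rw [symMapRingHom_algebraMap, symGrading, pow_zero]
    exact Submodule.algebraMap_mem _
  | add x y i hx hy ihx ihy => rw [map_add]; exact add_mem ihx ihy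
  | mem_mul m hm i x hx ih =>
    obtain ⟨m, rfl⟩ := hm
    rw [map_mul, symMapRingHom_ι, Nat.succ_eq_add_one, add_comm]
    exact SetLike.mul_mem_graded (ι_mem_symGrading _) ih

/-- The graded ring homomorphism `Sym_R M → Sym_S N` induced by a semilinear map `M → N`. -/
def symMap : GradedRingHom (symGrading R M) (symGrading S N) where
  toRingHom := symMapRingHom σ f
  map_mem := symMapRingHom_mem σ f

@[simp] lemma symMap_algebraMap (r : R) :
    symMap σ f (algebraMap R _ r) = algebraMap S _ (σ r) := symMapRingHom_algebraMap σ f r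

@[simp] lemma symMap_ι (m : M) :
    symMap σ f (SymmetricAlgebra.ι R M m) = SymmetricAlgebra.ι S N (f m) := symMapRingHom_ι σ f m

/-- The irrelevant ideal of `Sym M` is generated by any spanning set of `M`. -/
lemma irrelevant_le_span {κ : Type*} (b : κ → M) (hb : Submodule.span R (Set.range b) = ⊤) :
    (HomogeneousIdeal.irrelevant (symGrading R M)).toIdeal ≤
      Ideal.span (Set.range fun i => SymmetricAlgebra.ι R M (b i)) := by
  have key : ∀ m, SymmetricAlgebra.ι R M m ∈
      Ideal.span (Set.range fun i => SymmetricAlgebra.ι R M (b i)) := by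
    intro m
    have hm : m ∈ Submodule.span R (Set.range b) := hb ▸ Submodule.mem_top
    induction hm using Submodule.span_induction with
    | mem x hx => obtain ⟨i, rfl⟩ := hx; exact Ideal.subset_span ⟨i, rfl⟩
    | zero => simp
    | add x y _ _ hx hy => rw [map_add]; exact add_mem hx hy
    | smul r x _ hx => rw [map_smul, Algebra.smul_def]; exact Ideal.mul_mem_left _ _ hx
  rw [HomogeneousIdeal.toIdeal_irrelevant_le]
  intro i hi x hx
  obtain ⟨n, rfl⟩ : ∃ n, i = n + 1 := ⟨i - 1, by omega⟩
  have hx' : x ∈ LinearMap.range (SymmetricAlgebra.ι R M) *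
      LinearMap.range (SymmetricAlgebra.ι R M) ^ n := by
    rw [← pow_succ']; exact hx
  clear hx
  induction hx' using Submodule.mul_induction_on' with
  | mem_mul_mem m hm n hn => obtain ⟨m, rfl⟩ := hm; exact Ideal.mul_mem_right _ _ (key m)
  | add x hx y hy ihx ihy => exact add_mem ihx ihy

lemma irrelevant_le_map (hf : Submodule.span S (Set.range f) = ⊤) :
    HomogeneousIdeal.irrelevant (symGrading S N) ≤
      (HomogeneousIdeal.irrelevant (symGrading R M)).map (symMap σ f) := by
  refine (irrelevant_le_span f hf).trans ?_
  rw [Ideal.span_le]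
  rintro _ ⟨m, rfl⟩
  change SymmetricAlgebra.ι S N (f m) ∈ _
  rw [← symMap_ι]
  exact Ideal.mem_map_of_mem _
    (HomogeneousIdeal.mem_irrelevant_of_mem _ one_pos (ι_mem_symGrading m))

end SymMap

/-! ### Charts of `Proj (Sym M)` -/

section Chart

open HomogeneousLocalization

variable {R S : Type u} [CommRing R] [CommRing S] {M N : Type u} [AddCommGroup M] [Module R M]
  [AddCommGroup N] [Module S N]

/-- The structure map `R → (Sym M)_(x)` of a chart. -/
def awayBase (x : SymmetricAlgebra R M) : R →+* Away (symGrading R M) x :=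
  (fromZeroRingHom (symGrading R M) _).comp (algebraMap R (symGrading R M 0))

lemma val_awayBase (x : SymmetricAlgebra R M) (r : R) :
    (awayBase x r).val = algebraMap _ _ (algebraMap R (SymmetricAlgebra R M) r) := rfl

variable {κ : Type} (b : Module.Basis κ R M) (i : κ)

/-- The polynomial ring in the ratios `x_j / x_i`, mapping to the chart of `Proj (Sym M)` where
`x = x_i` does not vanish. -/
def polyToAway (x : SymmetricAlgebra R M) (hx : x = SymmetricAlgebra.ι R M (b i)) :
    MvPolynomial {j // j ≠ i} R →+* Away (symGrading R M) x :=
  MvPolynomial.eval₂Hom (awayBase x) fun j =>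
    Away.mk (symGrading R M) (hx ▸ ι_mem_symGrading (b i) : x ∈ symGrading R M 1) 1
      (SymmetricAlgebra.ι R M (b j)) (by simpa using ι_mem_symGrading (b j))

open Classical in
/-- Setting `x_i = 1`. -/
def dehomogenize : SymmetricAlgebra R M →ₐ[R] MvPolynomial {j // j ≠ i} R :=
  SymmetricAlgebra.lift (b.constr R fun j =>
    if h : j = i then (1 : MvPolynomial {j // j ≠ i} R) else MvPolynomial.X ⟨j, h⟩)

lemma dehomogenize_self : dehomogenize b i (SymmetricAlgebra.ι R M (b i)) = 1 := by
  simp [dehomogenize]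

lemma dehomogenize_ne (j : κ) (h : j ≠ i) :
    dehomogenize b i (SymmetricAlgebra.ι R M (b j)) = MvPolynomial.X ⟨j, h⟩ := by
  simp [dehomogenize, h]

/-- The inverse of `polyToAway`. -/
def awayToPoly : Away (symGrading R M) (SymmetricAlgebra.ι R M (b i)) →+*
    MvPolynomial {j // j ≠ i} R :=
  (IsLocalization.Away.lift (S := Localization.Away (SymmetricAlgebra.ι R M (b i)))
    (SymmetricAlgebra.ι R M (b i)) (g := (dehomogenize b i).toRingHom)
    (by
      change IsUnit (dehomogenize b i _)
      rw [dehomogenize_self]; exact isUnit_one)).comp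
    (algebraMap (Away (symGrading R M) (SymmetricAlgebra.ι R M (b i))) _)

lemma awayToPoly_mk (n : ℕ) (a : SymmetricAlgebra R M) (ha : a ∈ symGrading R M (n • 1)) :
    awayToPoly b i (Away.mk _ (ι_mem_symGrading (b i)) n a ha) = dehomogenize b i a := by
  rw [awayToPoly, RingHom.comp_apply, HomogeneousLocalization.algebraMap_apply, Away.val_mk,
    Localization.mk_eq_mk']
  erw [IsLocalization.lift_mk']
  rw [Units.mul_inv_eq_iff_eq_mul]
  erw [IsUnit.coe_liftRight]
  change dehomogenize b i a = dehomogenize b i a * dehomogenize b i (_ ^ n)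
  rw [map_pow, dehomogenize_self, one_pow, mul_one]

lemma awayToPoly_awayBase (r : R) :
    awayToPoly b i (awayBase _ r) = MvPolynomial.C r := by
  have : awayBase (SymmetricAlgebra.ι R M (b i)) r = Away.mk _ (ι_mem_symGrading (b i)) 0
      (algebraMap R _ r) (by simpa using SetLike.algebraMap_mem_graded _ r) := by
    apply val_injective
    rw [val_awayBase, Away.val_mk, ← Localization.mk_one_eq_algebraMap]
    congr 1
    ext; simp
  rw [this, awayToPoly_mk, AlgHom.commutes]
  rfl

lemma awayToPoly_polyToAway (p : MvPolynomial {j // j ≠ i} R) :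
    awayToPoly b i (polyToAway b i _ rfl p) = p := by
  have : (awayToPoly b i).comp (polyToAway b i _ rfl) = RingHom.id _ := by
    apply MvPolynomial.ringHom_ext
    · intro r; simp [polyToAway, awayToPoly_awayBase]
    · intro j
      simp [polyToAway, awayToPoly_mk, dehomogenize_ne b i j j.2]
  exact congr($this p)

lemma val_polyToAway_dehomogenize (n : ℕ) (a : SymmetricAlgebra R M) (ha : a ∈ symGrading R M n) :
    (polyToAway b i _ rfl (dehomogenize b i a)).val *
      algebraMap _ (Localization.Away (SymmetricAlgebra.ι R M (b i)))
        (SymmetricAlgebra.ι R M (b i)) ^ n = algebraMap _ _ a := by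
  induction ha using Submodule.pow_induction_on_left' with
  | algebraMap r =>
    rw [AlgHom.commutes, pow_zero, mul_one, MvPolynomial.algebraMap_eq, polyToAway,
      MvPolynomial.coe_eval₂Hom, MvPolynomial.eval₂_C, val_awayBase]
  | add x y n hx hy ihx ihy => rw [map_add, map_add, val_add, add_mul, ihx, ihy, map_add]
  | mem_mul m hm n x hx ih =>
    obtain ⟨m, rfl⟩ := hm
    rw [map_mul, map_mul, val_mul, pow_succ', mul_mul_mul_comm, ih, map_mul]
    congr 1
    clear ih hx x
    have hm : m ∈ Submodule.span R (Set.range b) := b.span_eq ▸ Submodule.mem_top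
    induction hm using Submodule.span_induction with
    | mem x hx =>
      obtain ⟨j, rfl⟩ := hx
      by_cases h : j = i
      · subst h
        rw [dehomogenize_self, map_one, val_one, one_mul]
      · rw [dehomogenize_ne b i j h, polyToAway, MvPolynomial.coe_eval₂Hom, MvPolynomial.eval₂_X,
          Away.val_mk, ← Localization.mk_one_eq_algebraMap, ← Localization.mk_one_eq_algebraMap,
          Localization.mk_mul, Localization.mk_eq_mk_iff, Localization.r_iff_exists]
        exact ⟨1, by simp [mul_comm]⟩
    | zero => simp
    | add x y _ _ hx hy => simp only [map_add, val_add, add_mul, hx, hy]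
    | smul r x _ hx =>
      simp only [map_smul, Algebra.smul_def, map_mul, val_mul, mul_assoc, hx]
      congr 1
      rw [AlgHom.commutes, MvPolynomial.algebraMap_eq, polyToAway,
        MvPolynomial.coe_eval₂Hom, MvPolynomial.eval₂_C, val_awayBase]

lemma polyToAway_bijective (x : SymmetricAlgebra R M) (hx : x = SymmetricAlgebra.ι R M (b i)) :
    Function.Bijective (polyToAway b i x hx) := by
  subst hx
  refine ⟨Function.LeftInverse.injective (awayToPoly_polyToAway b i), fun z => ?_⟩
  obtain ⟨n, a, ha, rfl⟩ := Away.mk_surjective _ (ι_mem_symGrading (b i)) z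
  refine ⟨dehomogenize b i a, val_injective _ ?_⟩
  have h := val_polyToAway_dehomogenize b i n a (by simpa using ha)
  rw [Away.val_mk, Localization.mk_eq_mk', eq_comm, IsLocalization.mk'_eq_iff_eq_mul, ← h]
  simp

variable (σ : R →+* S) (f : M →ₛₗ[σ] N) 

lemma awayMap_awayBase (x : SymmetricAlgebra R M) (r : R) :
    Away.map (symMap σ f) x (awayBase x r) = awayBase (symMap σ f x) (σ r) := by
  apply val_injective
  rw [val_awayBase, ← symMap_algebraMap σ f, ← Localization.mk_one_eq_algebraMap]
  change Localization.mk _ _ = _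
  congr 1
  ext; simp

/-- The chart of `Proj (Sym N)` is the base change of the chart of `Proj (Sym M)` if a basis of `M`
is mapped to a basis of `N`. -/
lemma isPushout_away (b' : Module.Basis κ S N) (hf : ∀ j, f (b j) = b' j) : IsPushout (CommRingCat.ofHom σ)
    (CommRingCat.ofHom (awayBase (SymmetricAlgebra.ι R M (b i))))
    (CommRingCat.ofHom (awayBase (symMap σ f (SymmetricAlgebra.ι R M (b i)))))
    (CommRingCat.ofHom (Away.map (symMap σ f) (SymmetricAlgebra.ι R M (b i)))) := by
  let _ : Algebra R S := σ.toAlgebra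
  let _ : Algebra (MvPolynomial {j // j ≠ i} R) (MvPolynomial {j // j ≠ i} S) :=
    MvPolynomial.algebraMvPolynomial
  refine (CommRingCat.isPushout_of_isPushout R S (MvPolynomial {j // j ≠ i} R)
    (MvPolynomial {j // j ≠ i} S)).of_iso (Iso.refl _) (Iso.refl _)
    (RingEquiv.ofBijective _ (polyToAway_bijective b i _ rfl)).toCommRingCatIso
    (RingEquiv.ofBijective _ (polyToAway_bijective b' i (symMap σ f (SymmetricAlgebra.ι R M (b i)))
      (by rw [symMap_ι, hf]))).toCommRingCatIso rfl ?_ ?_ ?_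
  · ext r
    simp [polyToAway]
  · ext r
    simp [polyToAway]
  · ext : 1
    apply MvPolynomial.ringHom_ext
    · intro r
      simp only [RingHom.coe_comp, CommRingCat.hom_comp, CommRingCat.hom_ofHom,
        RingEquiv.toCommRingCatIso_hom, Function.comp_apply, polyToAway, RingHom.coe_coe,
        RingEquiv.ofBijective_apply, MvPolynomial.coe_eval₂Hom, MvPolynomial.eval₂_C,
        awayMap_awayBase, MvPolynomial.algebraMap_def, MvPolynomial.map_C]
      rfl
    · intro r
      simp [polyToAway, hf]

end Chart

/-! ### Base change of `Proj (Sym M)` -/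

lemma isPullback_of_openCover {P X Y Z : Scheme.{u}} {fst : P ⟶ X} {snd : P ⟶ Y} {f : X ⟶ Z}
    {g : Y ⟶ Z} (w : fst ≫ f = snd ≫ g) (𝒰 : X.OpenCover) (W : 𝒰.I₀ → Scheme.{u})
    (a : ∀ i, W i ⟶ 𝒰.X i) (c : ∀ i, W i ⟶ P)
    (h₁ : ∀ i, IsPullback (a i) (c i) (𝒰.f i) fst)
    (h₂ : ∀ i, IsPullback (a i) (c i ≫ snd) (𝒰.f i ≫ f) g) : IsPullback fst snd f g := by
  obtain ⟨Q, p, q, hQ⟩ : ∃ (Q : Scheme.{u}) (p : Q ⟶ X) (q : Q ⟶ Y), IsPullback p q f g :=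
    ⟨_, _, _, IsPullback.of_hasPullback f g⟩
  obtain ⟨h, hp, hq⟩ : ∃ h : P ⟶ Q, h ≫ p = fst ∧ h ≫ q = snd :=
    ⟨hQ.lift fst snd w, hQ.lift_fst _ _ _, hQ.lift_snd _ _ _⟩
  have hiso : IsIso h := by
    change MorphismProperty.isomorphisms Scheme _
    rw [IsZariskiLocalAtTarget.iff_of_openCover (P := MorphismProperty.isomorphisms Scheme)
      (𝒰.pullback₁ p)]
    intro i
    have hQi : IsPullback (pullback.snd p (𝒰.f i)) (pullback.fst p (𝒰.f i)) (𝒰.f i) p :=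
      (IsPullback.of_hasPullback _ _).flip
    have hQi' := hQi.paste_vert hQ
    let k := (h₂ i).isoIsPullback _ _ hQi'
    have hk₁ : k.hom ≫ pullback.snd p (𝒰.f i) = a i := (h₂ i).isoIsPullback_hom_fst _ _ hQi'
    have hk₂ : k.hom ≫ pullback.fst p (𝒰.f i) = c i ≫ h := by
      apply hQ.hom_ext
      · rw [Category.assoc, ← hQi.w, reassoc_of% hk₁, Category.assoc, hp, (h₁ i).w]
      · rw [Category.assoc, Category.assoc, hq]
        exact (h₂ i).isoIsPullback_hom_snd _ _ hQi'
    have hk : IsPullback k.hom (c i) (pullback.fst p (𝒰.f i)) h :=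
      IsPullback.of_right (by rw [hk₁, hp]; exact h₁ i) hk₂ hQi
    have hP := (IsPullback.of_hasPullback h (pullback.fst p (𝒰.f i))).flip
    have : pullback.snd h (pullback.fst p (𝒰.f i)) = (hP.isoIsPullback _ _ hk).hom ≫ k.hom :=
      (hP.isoIsPullback_hom_fst _ _ hk).symm
    change IsIso (pullback.snd h (pullback.fst p (𝒰.f i)))
    rw [this]
    infer_instance
  exact hQ.of_iso (asIso h).symm (Iso.refl _) (Iso.refl _) (Iso.refl _)
    (by simp [← hp]) (by simp [← hq]) (by simp) (by simp)

section Proj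

open HomogeneousLocalization

variable {R S : Type u} [CommRing R] [CommRing S] {M N : Type u} [AddCommGroup M] [Module R M]
  [AddCommGroup N] [Module S N]

variable (R M) in
/-- The structure morphism `Proj (Sym_R M) ⟶ Spec R`. -/
def projToSpec : Proj (symGrading R M) ⟶ Spec (.of R) :=
  Proj.toSpecZero (symGrading R M) ≫
    Spec.map (CommRingCat.ofHom (algebraMap R (symGrading R M 0)))

lemma awayι_projToSpec {n : ℕ} (x : SymmetricAlgebra R M) (hx : x ∈ symGrading R M n)
    (hn : 0 < n) :
    Proj.awayι (symGrading R M) x hx hn ≫ projToSpec R M =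
      Spec.map (CommRingCat.ofHom (awayBase x)) := by
  rw [projToSpec, Proj.awayι_toSpecZero_assoc, ← Spec.map_comp]
  rfl

variable (σ : R →+* S) (f : M →ₛₗ[σ] N) (hf : Submodule.span S (Set.range f) = ⊤)

/-- The morphism `Proj (Sym_S N) ⟶ Proj (Sym_R M)` induced by a semilinear map `M → N` whose image
generates `N`. -/
def projMap : Proj (symGrading S N) ⟶ Proj (symGrading R M) :=
  Proj.map (symMap σ f) (irrelevant_le_map σ f hf)

lemma projMap_projToSpec :
    projMap σ f hf ≫ projToSpec R M = projToSpec S N ≫ Spec.map (CommRingCat.ofHom σ) := by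
  have key (n : ℕ) (hn : 0 < n) (x : SymmetricAlgebra R M) (hx : x ∈ symGrading R M n) :
      Proj.awayι (symGrading S N) (symMap σ f x) ((symMap σ f).map_mem hx) hn ≫
        projMap σ f hf ≫ projToSpec R M =
      Proj.awayι (symGrading S N) (symMap σ f x) ((symMap σ f).map_mem hx) hn ≫
        projToSpec S N ≫ Spec.map (CommRingCat.ofHom σ) := by
    rw [projMap, Proj.awayι_comp_map_assoc _ _ hn _ hx, awayι_projToSpec,
      ← Category.assoc, awayι_projToSpec, ← Spec.map_comp, ← Spec.map_comp]
    congr 1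
    ext r
    exact congrArg val (awayMap_awayBase σ f _ r)
  exact (Proj.mapAffineOpenCover _ (irrelevant_le_map σ f hf)).openCover.hom_ext _ _
    fun s => key s.1 s.1.2 s.2 s.2.2

lemma projMap_eq_id (σ : R →+* R) (f : M →ₛₗ[σ] M) (hf : Submodule.span R (Set.range f) = ⊤)
    (h₁ : ∀ r, σ r = r) (h₂ : ∀ m, f m = m) : projMap σ f hf = 𝟙 _ := by
  have key (φ : GradedRingHom (symGrading R M) (symGrading R M)) (hφ)
      (h : φ = GradedRingHom.id _) : Proj.map φ hφ = 𝟙 _ := by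
    subst h; exact Proj.map_id
  apply key
  refine GradedRingHom.ext fun x => ?_
  have : symMapRingHom σ f = RingHom.id _ := sym_ringHom_ext (by simp [h₁]) (by simp [h₂])
  exact congr($this x)

lemma projMap_comp {T : Type u} [CommRing T] {L : Type u} [AddCommGroup L] [Module T L]
    (τ : S →+* T) (g : N →ₛₗ[τ] L) (hg : Submodule.span T (Set.range g) = ⊤)
    (ρ : R →+* T) (k : M →ₛₗ[ρ] L) (hk : Submodule.span T (Set.range k) = ⊤)
    (h₁ : ∀ r, ρ r = τ (σ r)) (h₂ : ∀ m, k m = g (f m)) :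
    projMap ρ k hk = projMap τ g hg ≫ projMap σ f hf := by
  have key (φ : GradedRingHom (symGrading R M) (symGrading T L)) (hφ)
      (h : φ = (symMap τ g).comp (symMap σ f)) :
      Proj.map φ hφ = projMap τ g hg ≫ projMap σ f hf := by
    subst h; exact Proj.map_comp _ _ _ _
  apply key
  refine GradedRingHom.ext fun x => ?_
  have : symMapRingHom ρ k = (symMapRingHom τ g).comp (symMapRingHom σ f) :=
    sym_ringHom_ext (by simp [h₁]) (by simp [h₂])
  exact congr($this x)

lemma isPullback_projMap {κ : Type} (b : Module.Basis κ R M) (b' : Module.Basis κ S N)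
    (hb : ∀ j, f (b j) = b' j) :
    IsPullback (projMap σ f hf) (projToSpec S N) (projToSpec R M)
      (Spec.map (CommRingCat.ofHom σ)) := by
  let 𝒰 := Proj.affineOpenCoverOfIrrelevantLESpan (symGrading R M)
    (fun i => SymmetricAlgebra.ι R M (b i)) (m := fun _ => 1)
    (fun i => ι_mem_symGrading (b i)) (fun _ => one_pos) (irrelevant_le_span b b.span_eq)
  refine isPullback_of_openCover (projMap_projToSpec σ f hf) 𝒰.openCover
    (fun i => Spec (.of (Away (symGrading S N) (symMap σ f (SymmetricAlgebra.ι R M (b i))))))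
    (fun i => Spec.map (CommRingCat.ofHom (Away.map (symMap σ f) (SymmetricAlgebra.ι R M (b i)))))
    (fun i => Proj.awayι _ _ ((symMap σ f).map_mem (ι_mem_symGrading (b i))) one_pos) ?_ ?_
  · intro i
    refine IsOpenImmersion.isPullback _ _ _ _
      (Proj.awayι_comp_map (symMap σ f) _ one_pos _ (ι_mem_symGrading (b i))) ?_
    change _ ⁻¹ᵁ (Proj.awayι _ _ _ _).opensRange = _
    rw [Proj.opensRange_awayι, Proj.opensRange_awayι]
    rfl
  · intro i
    change IsPullback _ _ (Proj.awayι _ _ _ _ ≫ _) _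
    rw [awayι_projToSpec, awayι_projToSpec]
    exact (isPullback_SpecMap_of_isPushout _ _ _ _ (isPushout_away b i σ f b' hb)).flip

end Proj

/-! ### Vector bundles and projective bundles -/

section Bundle

variable {X : Scheme.{u}} (E : X.Modules)

/-- The restriction map `E(U) → E(V)` for `V ⊆ U`, semilinear over `𝒪(U) → 𝒪(V)`. -/
def res {U V : X.Opens} (h : V ≤ U) :
    Γ(E, U) →ₛₗ[(X.presheaf.map (homOfLE h).op).hom] Γ(E, V) where
  toFun := E.presheaf.map (homOfLE h).op
  map_add' x y := map_add _ x y
  map_smul' r x := Scheme.Modules.map_smul E (homOfLE h) r x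

lemma res_refl (U : X.Opens) (x : Γ(E, U)) : res E (le_refl U) x = x :=
  congr($(E.presheaf.map_id (Opposite.op U)) x)

lemma res_res {U V W : X.Opens} (h : V ≤ U) (h' : W ≤ V) (x : Γ(E, U)) :
    res E h' (res E h x) = res E (h'.trans h) x :=
  congr($(E.presheaf.map_comp (homOfLE h).op (homOfLE h').op) x).symm

/-- Sections `s₁, …, s_r` of `E` over `U` form a frame if they induce an isomorphism
`𝒪_U^r ≅ E|_U`, i.e. an isomorphism `𝒪(V)^r ≅ E(V)` for each open `V ⊆ U`. -/
def IsFrame {r : ℕ} {U : X.Opens} (s : Fin r → Γ(E, U)) : Prop :=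
  ∀ (V : X.Opens) (h : V ≤ U),
    Function.Bijective fun a : Fin r → Γ(X, V) => ∑ i, a i • res E h (s i)

/-- `E` is a vector bundle (locally free sheaf) of rank `r`: it has a frame of `r` sections in a
neighbourhood of each point. -/
class IsVectorBundle (r : ℕ) : Prop where
  exists_frame : ∀ x : X, ∃ U : X.Opens, x ∈ U ∧ ∃ s : Fin r → Γ(E, U), IsFrame E s

variable {E} in
lemma IsFrame.restrict {r : ℕ} {U V : X.Opens} {s : Fin r → Γ(E, U)} (hs : IsFrame E s)
    (h : V ≤ U) : IsFrame E fun i => res E h (s i) := by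
  intro W hW
  simp only [res_res]
  exact hs W (hW.trans h)

variable {E} in
/-- The basis of `E(V)` given by a frame over `U ⊇ V`. -/
def IsFrame.basis {r : ℕ} {U V : X.Opens} {s : Fin r → Γ(E, U)} (hs : IsFrame E s)
    (h : V ≤ U) : Module.Basis (Fin r) Γ(X, V) Γ(E, V) :=
  .ofEquivFun (LinearEquiv.ofBijective
    (Fintype.linearCombination Γ(X, V) fun i => res E h (s i)) (hs V h)).symm

variable {E} in
lemma IsFrame.basis_apply {r : ℕ} {U V : X.Opens} {s : Fin r → Γ(E, U)} (hs : IsFrame E s)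
    (h : V ≤ U) (i : Fin r) : hs.basis h i = res E h (s i) := by
  simp only [IsFrame.basis, Module.Basis.coe_ofEquivFun, LinearEquiv.symm_symm]
  change Fintype.linearCombination Γ(X, V) (fun i => res E h (s i)) (Pi.single i 1) = _
  rw [Fintype.linearCombination_apply_single, one_smul]

variable (r : ℕ)

/-- The affine opens of `X` over which `E` has a frame of `r` sections. -/
structure FrameOpens where
  /-- The underlying open subset. -/
  opens : X.Opens
  isAffine : IsAffineOpen opens
  exists_frame : ∃ s : Fin r → Γ(E, opens), IsFrame E s

instance : Preorder (FrameOpens E r) := Preorder.lift FrameOpens.opens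

lemma isBasis_frameOpens [IsVectorBundle E r] :
    Opens.IsBasis (Set.range (FrameOpens.opens : FrameOpens E r → X.Opens)) := by
  rw [Opens.isBasis_iff_nbhd]
  intro U x hx
  obtain ⟨V, hxV, s, hs⟩ := IsVectorBundle.exists_frame (E := E) (r := r) x
  obtain ⟨W, hW, hxW, hWUV⟩ := Opens.isBasis_iff_nbhd.mp X.isBasis_affineOpens
    (show x ∈ U ⊓ V from ⟨hx, hxV⟩)
  exact ⟨W, ⟨⟨W, hW, _, hs.restrict (hWUV.trans inf_le_right)⟩, rfl⟩, hxW,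
    hWUV.trans inf_le_left⟩

variable {E r} in
lemma span_range_res {U V : FrameOpens E r} (h : U ≤ V) :
    Submodule.span Γ(X, U.opens) (Set.range (res E (U := V.opens) (V := U.opens) h)) = ⊤ := by
  obtain ⟨s, hs⟩ := V.exists_frame
  rw [eq_top_iff, ← (hs.basis (V := U.opens) h).span_eq]
  refine Submodule.span_mono ?_
  rintro _ ⟨i, rfl⟩
  exact ⟨s i, (hs.basis_apply h i).symm⟩

variable {E r} in
lemma isoSpec_inv_homOfLE {U V : FrameOpens E r} (h : U ≤ V) :
    Spec.map (X.presheaf.map (homOfLE h : U.opens ⟶ V.opens).op) ≫ V.isAffine.isoSpec.inv =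
      U.isAffine.isoSpec.inv ≫ X.homOfLE (U := U.opens) (V := V.opens) h := by
  rw [Iso.comp_inv_eq, Category.assoc, Iso.eq_inv_comp]
  exact Scheme.Opens.toSpecΓ_SpecMap_presheaf_map U.opens V.opens h

lemma localProjToBase_aux {U V : FrameOpens E r} (h : U ≤ V) :
    projMap _ (res E (U := V.opens) (V := U.opens) h) (span_range_res h) ≫
      projToSpec Γ(X, V.opens) Γ(E, V.opens) ≫ V.isAffine.isoSpec.inv =
    (projToSpec Γ(X, U.opens) Γ(E, U.opens) ≫ U.isAffine.isoSpec.inv) ≫ X.homOfLE (U := U.opens) (V := V.opens) h := by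
  rw [← Category.assoc, projMap_projToSpec, Category.assoc, Category.assoc]
  congr 1
  exact isoSpec_inv_homOfLE h

lemma isPullback_localProj {U V : FrameOpens E r} (h : U ≤ V) :
    IsPullback (projMap _ (res E (U := V.opens) (V := U.opens) h) (span_range_res h))
      (projToSpec Γ(X, U.opens) Γ(E, U.opens) ≫ U.isAffine.isoSpec.inv)
      (projToSpec Γ(X, V.opens) Γ(E, V.opens) ≫ V.isAffine.isoSpec.inv)
      (X.homOfLE (U := U.opens) (V := V.opens) h) := by
  obtain ⟨s, hs⟩ := V.exists_frame
  have h₁ := isPullback_projMap _ (res E (U := V.opens) (V := U.opens) h)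
    (span_range_res h) (hs.basis (V := V.opens) le_rfl) (hs.basis (V := U.opens) h)
    (fun j => by rw [hs.basis_apply, hs.basis_apply, res_res])
  have h₂ : IsPullback (Spec.map (X.presheaf.map (homOfLE h : U.opens ⟶ V.opens).op))
      U.isAffine.isoSpec.inv V.isAffine.isoSpec.inv
      (X.homOfLE (U := U.opens) (V := V.opens) h) :=
    IsPullback.of_vert_isIso ⟨isoSpec_inv_homOfLE h⟩
  exact h₁.paste_vert h₂

variable [IsVectorBundle E r]

/-- The open cover of `X` by all affine opens over which `E` has a frame. -/
def frameCover : X.OpenCover where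
  I₀ := FrameOpens E r
  X U := U.opens
  f U := U.opens.ι
  mem₀ := by
    rw [Scheme.presieve₀_mem_precoverage_iff]
    refine ⟨fun x ↦ ?_, inferInstance⟩
    obtain ⟨_, ⟨U, rfl⟩, hxU, -⟩ := Opens.isBasis_iff_nbhd.mp (isBasis_frameOpens E r)
      (Opens.mem_top x)
    exact ⟨U, by simpa using hxU⟩

instance : Preorder (frameCover E r).I₀ := inferInstanceAs (Preorder (FrameOpens E r))

instance : Scheme.Cover.LocallyDirected (frameCover E r) :=
  .ofIsBasisOpensRange
    (fun {i j} => by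
      change i ≤ j ↔ (FrameOpens.opens i).ι.opensRange ≤ (FrameOpens.opens j).ι.opensRange
      rw [Scheme.Opens.opensRange_ι, Scheme.Opens.opensRange_ι]
      rfl)
    (by
      change Opens.IsBasis (Set.range fun i => (FrameOpens.opens i).ι.opensRange)
      simp only [Scheme.Opens.opensRange_ι]
      exact isBasis_frameOpens E r)

lemma frameCover_trans {U V : FrameOpens E r} (h : U ≤ V) :
    (frameCover E r).trans (i := U) (j := V) (homOfLE h) = X.homOfLE (U := U.opens) (V := V.opens) h := rfl

/-- The functor `U ↦ Proj (Sym E(U))` on the affine opens over which `E` has a frame. -/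
def localProj : FrameOpens E r ⥤ Scheme.{u} where
  obj U := Proj (symGrading Γ(X, U.opens) Γ(E, U.opens))
  map {U V} h := projMap _ (res E (U := V.opens) (V := U.opens) (leOfHom h))
    (span_range_res (leOfHom h))
  map_id U := projMap_eq_id _ _ _ (fun x => congr($(X.presheaf.map_id (Opposite.op U.opens)) x))
    (res_refl E _)
  map_comp {U V W} h h' := projMap_comp _ _ _ _ _ _ _ _ _
    (fun x => congr($(X.presheaf.map_comp (homOfLE (leOfHom h') : V.opens ⟶ W.opens).op
      (homOfLE (leOfHom h) : U.opens ⟶ V.opens).op) x))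
    (fun m => (res_res E (U := W.opens) (V := V.opens) (W := U.opens) _ _ m).symm)

/-- The structure morphisms `Proj (Sym E(U)) ⟶ Spec 𝒪(U) ≅ U`. -/
def localProjToBase : localProj E r ⟶ (frameCover E r).functorOfLocallyDirected where
  app U := projToSpec Γ(X, U.opens) Γ(E, U.opens) ≫ U.isAffine.isoSpec.inv
  naturality _ _ h := localProjToBase_aux E r (leOfHom h)

/-- The gluing data for `ℙ(E)`. -/
def projGluingData : (frameCover E r).RelativeGluingData where
  functor := localProj E r
  natTrans := localProjToBase E r
  equifibered U V h := isPullback_localProj E r (U := U) (V := V) (leOfHom h)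

instance : Small.{u} (frameCover E r).I₀ := inferInstanceAs (Small.{u} (FrameOpens E r))

instance : Quiver.IsThin (frameCover E r).I₀ := inferInstanceAs (Quiver.IsThin (FrameOpens E r))

/-- The projective bundle `ℙ(E) = Proj (Sym E)` of a vector bundle `E` of rank `r` on `X`, glued
from the schemes `Proj (Sym E(U))`. -/
def ProjBundle : Scheme.{u} := (projGluingData E r).glued

/-- The projection `ℙ(E) ⟶ X`. -/
def ProjBundle.toBase : ProjBundle E r ⟶ X := (projGluingData E r).toBase

end Bundle

/-! ### Differentials -/

section Diff

variable {k : Type u} [Field k]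

/-- For a `k`-scheme `X`, the morphism `k → 𝒪_X` from the constant presheaf. -/
def constToPresheaf {X : Scheme.{u}} (x : X ⟶ Spec (.of k)) :
    (Functor.const X.Opensᵒᵖ).obj (CommRingCat.of k) ⟶ X.presheaf where
  app U := (Scheme.ΓSpecIso (.of k)).inv ≫ x.appTop ≫ X.presheaf.map (homOfLE le_top).op
  naturality U V i := by
    simp only [Functor.const_obj_obj, Functor.const_obj_map, Category.id_comp, Category.assoc,
      ← Functor.map_comp]
    rfl

/-- The presheaf `U ↦ Ω_{𝒪(U)/k}`. -/
def presheafOmega {X : Scheme.{u}} (x : X ⟶ Spec (.of k)) : X.PresheafOfModules :=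
  PresheafOfModules.DifferentialsConstruction.relativeDifferentials' (constToPresheaf x)

/-- The cotangent sheaf `Ω¹_X = Ω¹_{X/k}` of a `k`-scheme `X`: the sheaf associated to
`U ↦ Ω_{𝒪(U)/k}`. -/
def Omega {X : Scheme.{u}} (x : X ⟶ Spec (.of k)) : X.Modules :=
  (PresheafOfModules.sheafification (𝟙 X.ringCatSheaf.obj)).obj (presheafOmega x)

/-- The canonical map from the presheaf `U ↦ Ω_{𝒪(U)/k}` to the associated sheaf. -/
def toOmega {X : Scheme.{u}} (x : X ⟶ Spec (.of k)) :
    presheafOmega x ⟶ (Scheme.Modules.toPresheafOfModules X).obj (Omega x) :=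
  (PresheafOfModules.sheafificationAdjunction (𝟙 X.ringCatSheaf.obj)).unit.app (presheafOmega x)

/-- The universal derivation `d : 𝒪_X → Ω¹_X`. -/
def omegaD {X : Scheme.{u}} (x : X ⟶ Spec (.of k)) :
    ((Scheme.Modules.toPresheafOfModules X).obj (Omega x)).Derivation' (constToPresheaf x) :=
  (PresheafOfModules.DifferentialsConstruction.derivation' (constToPresheaf x)).postcomp (toOmega x)

/-- The universal derivation on sections over `U`. -/
def omegaDOn {X : Scheme.{u}} (x : X ⟶ Spec (.of k)) (U : X.Opens) : Γ(X, U) →+ Γ(Omega x, U) :=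
  (omegaD x).d (X := Opposite.op U)

lemma omegaDOn_mul {X : Scheme.{u}} (x : X ⟶ Spec (.of k)) (U : X.Opens) (a b : Γ(X, U)) :
    omegaDOn x U (a * b) = a • omegaDOn x U b + b • omegaDOn x U a :=
  (omegaD x).d_mul a b

lemma omegaDOn_map {X : Scheme.{u}} (x : X ⟶ Spec (.of k)) {U V : X.Opens} (i : V ⟶ U)
    (a : Γ(X, U)) :
    omegaDOn x V (X.presheaf.map i.op a) = (Omega x).presheaf.map i.op (omegaDOn x U a) :=
  (omegaD x).d_map i.op a

lemma omegaDOn_const {X : Scheme.{u}} (x : X ⟶ Spec (.of k)) (U : X.Opens) (a : k) :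
    omegaDOn x U ((constToPresheaf x).app (Opposite.op U) a) = 0 :=
  (omegaD x).d_app (X := Opposite.op U) a

variable {X C : Scheme.{u}} (π : X ⟶ C) (c : C ⟶ Spec (.of k))

lemma constToPresheaf_app (U : C.Opens) :
    (constToPresheaf c).app (Opposite.op U) ≫ π.app U =
      (constToPresheaf (π ≫ c)).app (Opposite.op (π ⁻¹ᵁ U)) := by
  simp only [constToPresheaf, Category.assoc, Scheme.Hom.comp_appTop]
  rw [π.naturality]
  rfl

/-- For `π : X ⟶ C`, the derivation `𝒪_C → π_* 𝒪_X → π_* Ω¹_X`. -/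
def pushforwardD : ((Scheme.Modules.toPresheafOfModules C).obj
      ((Scheme.Modules.pushforward π).obj (Omega (π ≫ c)))).Derivation' (constToPresheaf c) where
  d {U} := (omegaDOn (π ≫ c) (π ⁻¹ᵁ U.unop)).comp (π.app U.unop).hom.toAddMonoidHom
  d_mul {U} a b := by
    refine Eq.trans (congrArg (omegaDOn (π ≫ c) (π ⁻¹ᵁ U.unop))
      (map_mul (π.app U.unop).hom a b)) ?_
    exact omegaDOn_mul (π ≫ c) (π ⁻¹ᵁ U.unop) _ _
  d_map {U V} i f := by
    refine Eq.trans (congrArg (omegaDOn (π ≫ c) (π ⁻¹ᵁ V.unop)) congr($(π.naturality i) f)) ?_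
    exact omegaDOn_map (π ≫ c) ((Opens.map π.base).map i.unop) _
  d_app {U} a := by
    refine Eq.trans (congrArg (omegaDOn (π ≫ c) (π ⁻¹ᵁ U.unop))
      congr($(constToPresheaf_app π c U.unop) a)) ?_
    exact omegaDOn_const (π ≫ c) (π ⁻¹ᵁ U.unop) a

/-- The natural map `η : Ω¹_C ⟶ π_* Ω¹_X` of `𝒪_C`-modules: the one with `η (df) = d (f ∘ π)`. -/
def eta : Omega c ⟶ (Scheme.Modules.pushforward π).obj (Omega (π ≫ c)) :=
  ((PresheafOfModules.sheafificationAdjunction (𝟙 C.ringCatSheaf.obj)).homEquiv _ _).symm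
    ((PresheafOfModules.DifferentialsConstruction.isUniversal' (constToPresheaf c)).desc
      (pushforwardD π c))

/-- The map `η` is characterized by `η (df) = d (f ∘ π)`. -/
lemma eta_omegaDOn (U : C.Opens) (f : Γ(C, U)) :
    (eta π c).app U (omegaDOn c U f) = omegaDOn (π ≫ c) (π ⁻¹ᵁ U) (π.app U f) := by
  have h₁ := ((PresheafOfModules.sheafificationAdjunction (𝟙 C.ringCatSheaf.obj)).homEquiv
    (presheafOmega c) ((Scheme.Modules.pushforward π).obj (Omega (π ≫ c)))).apply_symm_apply
    ((PresheafOfModules.DifferentialsConstruction.isUniversal' (constToPresheaf c)).desc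
      (pushforwardD π c))
  have h₂ := (PresheafOfModules.DifferentialsConstruction.isUniversal' (constToPresheaf c)).fac
    (pushforwardD π c)
  have h₃ := PresheafOfModules.Derivation.congr_d h₂ (X := Opposite.op U) f
  refine Eq.trans ?_ h₃
  have h₄ : toOmega c ≫ (Scheme.Modules.toPresheafOfModules C).map (eta π c) =
      (PresheafOfModules.DifferentialsConstruction.isUniversal' (constToPresheaf c)).desc
        (pushforwardD π c) := h₁
  exact congrArg (fun g => ((PresheafOfModules.DifferentialsConstruction.derivation'
    (constToPresheaf c)).postcomp g).d (X := Opposite.op U) f) h₄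

end Diff

section Curve

attribute [local instance] MvPolynomial.gradedAlgebra

variable {k : Type u} [Field k]

/-- Projective `n`-space `ℙⁿ_k = Proj k[x₀, …, x_n]`. -/
def ProjSpace (k : Type u) [Field k] (n : ℕ) : Scheme.{u} :=
  Proj (MvPolynomial.homogeneousSubmodule (Fin (n + 1)) k)

/-- The structure morphism `ℙⁿ_k ⟶ Spec k`. -/
def ProjSpace.toSpec (k : Type u) [Field k] (n : ℕ) : ProjSpace k n ⟶ Spec (.of k) :=
  Proj.toSpecZero (MvPolynomial.homogeneousSubmodule (Fin (n + 1)) k) ≫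
    Spec.map (CommRingCat.ofHom
      (algebraMap k (MvPolynomial.homogeneousSubmodule (Fin (n + 1)) k 0)))

/-- `c : C ⟶ Spec k` is a smooth irreducible projective curve over `k`. -/
structure IsSmoothProjectiveCurve {C : Scheme.{u}} (c : C ⟶ Spec (.of k)) : Prop where
  irreducible : IrreducibleSpace C
  smooth : SmoothOfRelativeDimension 1 c
  projective : ∃ (n : ℕ) (i : C ⟶ ProjSpace k n),
    IsClosedImmersion i ∧ i ≫ ProjSpace.toSpec k n = c

/-- `π : X ⟶ C` is the ruled surface `ℙ_C(E) ⟶ C` of the rank two vector bundle `E` on `C`, i.e.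
`X` is isomorphic to `ℙ_C(E)` over `C`. -/
def IsRuledSurface {X C : Scheme.{u}} (π : X ⟶ C) (E : C.Modules) [IsVectorBundle E 2] : Prop :=
  ∃ e : X ≅ ProjBundle E 2, e.hom ≫ ProjBundle.toBase E 2 = π

end Curve

end

end RuledSurface

/-!
The statement is local on `C`, so let `U = Spec A` be an affine open over which `E` is free. Over
`U` the surface is obtained by gluing `Spec B₀` and `Spec B₁`, where `B₀ = A[t]` and `B₁ = A[t⁻¹]`,
along `Spec L`, where `L = A[t, t⁻¹]`. On affine opens the sections of `Ω¹` are Kähler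
differentials, so the claim is that `Ω_A` is the equalizer of `Ω_{B₀} × Ω_{B₁} ⇉ Ω_L`. Two
differentials that agree over `L` have vanishing image in the differentials relative to `A`: these
are `p(t) dt` and `q(t⁻¹) d(t⁻¹) = -t⁻² q(t⁻¹) dt`, and only `0` has both forms. Hence they come
from `B₀ ⊗ Ω_A` and `B₁ ⊗ Ω_A`, and they agree in `L ⊗ Ω_A`, which embeds in `Ω_L` because `L` is
smooth over `A`; so they are the constant sections given by an element of `Ω_A`.
-/

namespace RuledSurface

noncomputable section

section LaurentPolynomials

open Polynomial LaurentPolynomial KaehlerDifferential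

variable {A : Type*} [CommRing A]

/-- The projection of Laurent polynomials to polynomials that drops the terms of negative degree,
as an `A`-linear map. -/
def truncLinear : A[T;T⁻¹] →ₗ[A] A[X] where
  toFun := trunc
  map_add' := map_add _
  map_smul' r p := by
    induction p using LaurentPolynomial.induction_on' with
    | add p q hp hq => rw [smul_add, map_add, hp, hq, map_add, smul_add]
    | C_mul_T n a =>
      rw [LaurentPolynomial.smul_eq_C_mul, ← mul_assoc, ← map_mul, trunc_C_mul_T, trunc_C_mul_T]
      split_ifs <;> simp [smul_monomial]

lemma truncLinear_toLaurent (p : A[X]) : truncLinear (toLaurent p) = p :=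
  trunc_toLaurent p

lemma truncLinear_invert_toLaurent (p : A[X]) :
    truncLinear (invert (toLaurent p)) = Polynomial.C (p.coeff 0) := by
  change trunc _ = _
  induction p using Polynomial.induction_on' with
  | add p q hp hq => simp only [map_add, hp, hq, coeff_add]
  | monomial n a =>
    rw [← C_mul_X_pow_eq_monomial, toLaurent_C_mul_X_pow, map_mul, invert_C, invert_T,
      trunc_C_mul_T]
    rcases n with _ | n
    · simp
    · rw [if_neg (by push_cast; lia)]; simp

instance : IsScalarTower A A[X] A[T;T⁻¹] := .of_algebraMap_eq fun a => by
  rw [algebraMap_eq_toLaurent, Polynomial.algebraMap_eq, toLaurent_C,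
    LaurentPolynomial.C_eq_algebraMap]

instance : Algebra.FormallyEtale A[X] A[T;T⁻¹] := .of_isLocalization (.powers X)

instance : Algebra.FormallySmooth A A[T;T⁻¹] := .comp A A[X] A[T;T⁻¹]

lemma eq_zero_of_smul_D_X_eq_zero {L : Type*} [CommRing L] [Algebra A L] [Algebra A[X] L]
    [IsScalarTower A A[X] L] [Algebra.FormallyEtale A[X] L] {f : L}
    (h : f • D A L (algebraMap A[X] L X) = 0) : f = 0 := by
  let E := (tensorKaehlerEquivOfFormallyEtale A A[X] L).symm ≪≫ₗ
    (polynomialEquiv A).baseChange A[X] L _ _ ≪≫ₗ TensorProduct.AlgebraTensorModule.rid A[X] L L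
  have hE : E (D A L (algebraMap A[X] L X)) = 1 := by
    simp [E, tensorKaehlerEquivOfFormallyEtale_symm_D_algebraMap]
  simpa [hE] using congr(E $h)

lemma exists_smul_D_X_eq {B : Type*} [CommRing B] [Algebra A B] [Algebra A[X] B]
    [IsScalarTower A A[X] B] (hB : Function.Surjective (algebraMap A[X] B)) (z : Ω[B⁄A]) :
    ∃ p : A[X], algebraMap A[X] B p • D A B (algebraMap A[X] B X) = z := by
  obtain ⟨w, rfl⟩ := map_surjective_of_surjective A A A[X] B hB z
  obtain ⟨p, rfl⟩ := (polynomialEquiv A).symm.surjective w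
  exact ⟨p, by simp⟩

end LaurentPolynomials

section Kaehler

open KaehlerDifferential TensorProduct

lemma mapBaseChange_injective (k A B : Type*) [CommRing k] [CommRing A]
    [CommRing B] [Algebra k A] [Algebra k B] [Algebra A B] [IsScalarTower k A B]
    [Algebra.FormallySmooth A B] : Function.Injective (mapBaseChange k A B) := by
  rw [injective_iff_map_eq_zero]
  intro x hx
  obtain ⟨x, rfl⟩ := (Algebra.H1Cotangent.exact_δ_mapBaseChange k A B x).mp hx
  rw [Subsingleton.elim x 0, map_zero]

lemma kaehler_map_map (R S T : Type*) {A B C : Type*} [CommRing R] [CommRing S] [CommRing T]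
    [CommRing A] [CommRing B] [CommRing C] [Algebra R S] [Algebra S T] [Algebra R T] [Algebra R A]
    [Algebra S B] [Algebra T C] [Algebra A B] [Algebra B C] [Algebra A C] [Algebra R B]
    [Algebra S C] [Algebra R C] [IsScalarTower R A B] [IsScalarTower R S B] [IsScalarTower S B C]
    [IsScalarTower S T C] [IsScalarTower R A C] [IsScalarTower R T C] [IsScalarTower A B C]
    (x : Ω[A⁄R]) : map S T B C (map R S A B x) = map R T A C x := by
  have hx : x ∈ Submodule.span A (Set.range (D R A)) := by
    rw [span_range_derivation]; trivial
  induction hx using Submodule.span_induction with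
  | mem z hz =>
    obtain ⟨a, rfl⟩ := hz
    rw [map_D, map_D, map_D, ← IsScalarTower.algebraMap_apply]
  | zero => simp
  | add x y _ _ hx hy => simp only [map_add, hx, hy]
  | smul a x _ hx =>
    rw [(map R S A B).map_smul, (map R T A C).map_smul, ← hx,
      LinearMap.map_smul_of_tower (map S T B C)]

lemma mapBaseChange_rTensor (k : Type*) {A B L : Type*} [CommRing k] [CommRing A] [CommRing B]
    [CommRing L] [Algebra k A] [Algebra k B] [Algebra k L] [Algebra A B] [Algebra A L] [Algebra B L]
    [IsScalarTower k A B] [IsScalarTower k A L] [IsScalarTower k B L] [IsScalarTower A B L]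
    (u : B ⊗[A] Ω[A⁄k]) :
    mapBaseChange k A L ((IsScalarTower.toAlgHom A B L).toLinearMap.rTensor _ u) =
      map k k B L (mapBaseChange k A B u) := by
  induction u with
  | zero => simp
  | add u v hu hv => simp only [map_add, hu, hv]
  | tmul b ω =>
    rw [LinearMap.rTensor_tmul, mapBaseChange_tmul, mapBaseChange_tmul, LinearMap.map_smul,
      kaehler_map_map, ← algebraMap_smul L b]
    rfl

end Kaehler

section Coordinates

open Polynomial LaurentPolynomial KaehlerDifferential TensorProduct

/-- Coordinates exhibiting `Spec L ⇉ Spec B₀, Spec B₁` as the standard affine charts of the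
projective line over `A` with their intersection: `B₀ = A[T]`, `B₁ = A[T⁻¹]` and
`L = A[T, T⁻¹]`. -/
structure ProjectiveLineCoordinates {A B₀ B₁ L : Type*} [CommRing A] [CommRing B₀] [CommRing B₁]
    [CommRing L] (φ₀ : A →+* B₀) (φ₁ : A →+* B₁) (ψ₀ : B₀ →+* L) (ψ₁ : B₁ →+* L) where
  e₀ : A[X] ≃+* B₀
  e₁ : A[X] ≃+* B₁
  e : A[T;T⁻¹] ≃+* L
  e₀_C (a : A) : e₀ (Polynomial.C a) = φ₀ a
  e₁_C (a : A) : e₁ (Polynomial.C a) = φ₁ a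
  map_e₀ (p : A[X]) : ψ₀ (e₀ p) = e (toLaurent p)
  map_e₁ (p : A[X]) : ψ₁ (e₁ p) = e (invert (toLaurent p))

namespace ProjectiveLineCoordinates

section RingHom

variable {A B₀ B₁ L : Type*} [CommRing A] [CommRing B₀] [CommRing B₁] [CommRing L]
  {φ₀ : A →+* B₀} {φ₁ : A →+* B₁} {ψ₀ : B₀ →+* L} {ψ₁ : B₁ →+* L}

/-- Coordinates built from functions `t` on the first chart and `s` on the second that are inverse
to each other on the intersection, the nonvanishing locus of `t`. -/
def ofIsLocalization (hψ : ψ₀.comp φ₀ = ψ₁.comp φ₁) (t : B₀) (s : B₁)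
    (ht : Function.Bijective (eval₂RingHom φ₀ t)) (hs : Function.Bijective (eval₂RingHom φ₁ s))
    (hL : letI := ψ₀.toAlgebra; IsLocalization.Away t L) (hts : ψ₀ t * ψ₁ s = 1) :
    ProjectiveLineCoordinates φ₀ φ₁ ψ₀ ψ₁ :=
  letI := ψ₀.toAlgebra
  let e₀ := RingEquiv.ofBijective _ ht
  let e₁ := RingEquiv.ofBijective _ hs
  have hT : (Submonoid.powers (X : A[X])).map e₀.toMonoidHom = .powers t := by
    rw [Submonoid.map_powers]
    exact congrArg _ (eval₂_X φ₀ t)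
  let e : A[T;T⁻¹] ≃+* L := IsLocalization.ringEquivOfRingEquiv A[T;T⁻¹] L e₀ hT
  have he (p : A[X]) : e (toLaurent p) = ψ₀ (e₀ p) := IsLocalization.ringEquivOfRingEquiv_eq hT p
  have he_inv : e (T (-1)) = ψ₁ s := by
    have ht' : e (T 1) = ψ₀ t := by
      rw [← toLaurent_X, he]
      exact congrArg ψ₀ (Polynomial.eval₂_X φ₀ t)
    have hT' : e (T (-1)) * e (T 1) = 1 := by rw [← map_mul, ← T_add]; simp
    exact left_inv_eq_right_inv hT' (ht' ▸ hts)
  have hs' : ψ₁.comp (eval₂RingHom φ₁ s) =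
      e.toRingHom.comp (invert.toRingEquiv.toRingHom.comp toLaurent) := by
    refine Polynomial.ringHom_ext (fun a => ?_) ?_
    · have h : ψ₀ (e₀ (Polynomial.C a)) = ψ₁ (φ₁ a) :=
        (congrArg ψ₀ (Polynomial.eval₂_C φ₀ t)).trans (RingHom.congr_fun hψ a)
      simpa [← he] using h.symm
    · simpa using he_inv.symm
  { e₀, e₁, e
    e₀_C a := Polynomial.eval₂_C φ₀ t
    e₁_C a := Polynomial.eval₂_C φ₁ s
    map_e₀ p := (he p).symm
    map_e₁ p := RingHom.congr_fun hs' p }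

/-- The same coordinates with the two charts exchanged. -/
def symm (P : ProjectiveLineCoordinates φ₀ φ₁ ψ₀ ψ₁) : ProjectiveLineCoordinates φ₁ φ₀ ψ₁ ψ₀ where
  e₀ := P.e₁
  e₁ := P.e₀
  e := invert.toRingEquiv.trans P.e
  e₀_C := P.e₁_C
  e₁_C := P.e₀_C
  map_e₀ := P.map_e₁
  map_e₁ p := by
    rw [P.map_e₀]
    exact congrArg P.e (involutive_invert _).symm

/-- Coordinates transported along isomorphisms of the charts and of their intersection. -/
def congr (P : ProjectiveLineCoordinates φ₀ φ₁ ψ₀ ψ₁) {B₀' B₁' L' : Type*} [CommRing B₀']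
    [CommRing B₁'] [CommRing L'] {φ₀' : A →+* B₀'} {φ₁' : A →+* B₁'} {ψ₀' : B₀' →+* L'}
    {ψ₁' : B₁' →+* L'} (α₀ : B₀ ≃+* B₀') (α₁ : B₁ ≃+* B₁') (α : L ≃+* L')
    (hφ₀ : ∀ a, α₀ (φ₀ a) = φ₀' a) (hφ₁ : ∀ a, α₁ (φ₁ a) = φ₁' a)
    (hψ₀ : ∀ b, ψ₀' (α₀ b) = α (ψ₀ b)) (hψ₁ : ∀ b, ψ₁' (α₁ b) = α (ψ₁ b)) :
    ProjectiveLineCoordinates φ₀' φ₁' ψ₀' ψ₁' where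
  e₀ := P.e₀.trans α₀
  e₁ := P.e₁.trans α₁
  e := P.e.trans α
  e₀_C a := (congrArg α₀ (P.e₀_C a)).trans (hφ₀ a)
  e₁_C a := (congrArg α₁ (P.e₁_C a)).trans (hφ₁ a)
  map_e₀ p := (hψ₀ _).trans (congrArg α (P.map_e₀ p))
  map_e₁ p := (hψ₁ _).trans (congrArg α (P.map_e₁ p))

end RingHom

section Algebra

variable {A B₀ B₁ L : Type*} [CommRing A] [CommRing B₀] [CommRing B₁] [CommRing L]
  [Algebra A B₀] [Algebra A B₁] [Algebra A L] [Algebra B₀ L] [Algebra B₁ L]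
  [IsScalarTower A B₀ L]

variable (P : ProjectiveLineCoordinates (algebraMap A B₀) (algebraMap A B₁) (algebraMap B₀ L)
  (algebraMap B₁ L))

/-- The coordinate of the intersection of the charts, as an isomorphism of `A`-algebras. -/
def algEquiv : A[T;T⁻¹] ≃ₐ[A] L := AlgEquiv.ofRingEquiv (f := P.e) fun a => by
  rw [← LaurentPolynomial.C_eq_algebraMap, ← toLaurent_C, ← P.map_e₀, P.e₀_C,
    ← IsScalarTower.algebraMap_apply]

include P in
lemma formallySmooth : Algebra.FormallySmooth A L := .of_equiv P.algEquiv

/-- The `A`-linear retraction of `B₀ → L` that drops the terms of negative degree. -/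
def retraction : L →ₗ[A] B₀ :=
  (AlgEquiv.ofRingEquiv (f := P.e₀) P.e₀_C).toLinearMap ∘ₗ truncLinear ∘ₗ
    P.algEquiv.symm.toLinearMap

lemma retraction_algebraMap₀ (b : B₀) : P.retraction (algebraMap B₀ L b) = b := by
  obtain ⟨p, rfl⟩ := P.e₀.surjective b
  simp [retraction, P.map_e₀, truncLinear_toLaurent, algEquiv]

lemma retraction_algebraMap₁ (b : B₁) :
    P.retraction (algebraMap B₁ L b) = algebraMap A B₀ ((P.e₁.symm b).coeff 0) := by
  obtain ⟨p, rfl⟩ := P.e₁.surjective b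
  simp [retraction, algEquiv, P.map_e₁, truncLinear_invert_toLaurent, P.e₀_C]

/-- The `A`-linear projection of `L` onto the constant terms. -/
def constantTerm : L →ₗ[A] A :=
  lcoeff A 0 ∘ₗ truncLinear ∘ₗ P.algEquiv.symm.toLinearMap

lemma constantTerm_one : P.constantTerm 1 = 1 := by
  have h : truncLinear (1 : A[T;T⁻¹]) = 1 := by
    rw [← map_one toLaurent, truncLinear_toLaurent]
  simp [constantTerm, h]

include P in
lemma one_tmul_injective (M : Type*) [AddCommGroup M] [Module A M] :
    Function.Injective fun m : M => (1 : L) ⊗ₜ[A] m := fun m n h => by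
  simpa [constantTerm_one] using congr(TensorProduct.lid A M (P.constantTerm.rTensor M $h))

include P in
lemma map_injective (k : Type*) [CommRing k] [Algebra k A] [Algebra k B₀] [Algebra k L]
    [IsScalarTower k A B₀] [IsScalarTower k A L] [IsScalarTower k B₀ L] :
    Function.Injective (map k k A B₀) := by
  have : Algebra.FormallySmooth A L := P.formallySmooth
  refine .of_comp (f := map k k B₀ L) ?_
  convert (mapBaseChange_injective k A L).comp (P.one_tmul_injective Ω[A⁄k]) using 1
  ext ω
  simp [kaehler_map_map]

variable [IsScalarTower A B₁ L]

lemma exists_rTensor_retraction_eq {M : Type*} [AddCommGroup M] [Module A M] (v : B₁ ⊗[A] M) :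
    ∃ m : M, P.retraction.rTensor M
      ((IsScalarTower.toAlgHom A B₁ L).toLinearMap.rTensor M v) = 1 ⊗ₜ m := by
  induction v with
  | zero => exact ⟨0, by simp⟩
  | add v w hv hw =>
    obtain ⟨m, hm⟩ := hv
    obtain ⟨n, hn⟩ := hw
    exact ⟨m + n, by rw [map_add, map_add, hm, hn, TensorProduct.tmul_add]⟩
  | tmul b m =>
    refine ⟨(P.e₁.symm b).coeff 0 • m, ?_⟩
    rw [LinearMap.rTensor_tmul, LinearMap.rTensor_tmul, ← TensorProduct.smul_tmul,
      ← Algebra.algebraMap_eq_smul_one, ← retraction_algebraMap₁]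
    rfl

include P in
lemma exists_eq_one_tmul {M : Type*} [AddCommGroup M] [Module A M] {u : B₀ ⊗[A] M}
    {v : B₁ ⊗[A] M}
    (huv : (IsScalarTower.toAlgHom A B₀ L).toLinearMap.rTensor M u =
      (IsScalarTower.toAlgHom A B₁ L).toLinearMap.rTensor M v) :
    ∃ m : M, u = 1 ⊗ₜ m := by
  obtain ⟨m, hm⟩ := P.exists_rTensor_retraction_eq v
  refine ⟨m, ?_⟩
  have h : P.retraction ∘ₗ (IsScalarTower.toAlgHom A B₀ L).toLinearMap = LinearMap.id :=
    LinearMap.ext P.retraction_algebraMap₀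
  rw [← hm, ← huv, ← LinearMap.rTensor_comp_apply, h, LinearMap.rTensor_id_apply]

include P in
lemma exists_eq_one_tmul_and {M : Type*} [AddCommGroup M] [Module A M] {u : B₀ ⊗[A] M}
    {v : B₁ ⊗[A] M}
    (huv : (IsScalarTower.toAlgHom A B₀ L).toLinearMap.rTensor M u =
      (IsScalarTower.toAlgHom A B₁ L).toLinearMap.rTensor M v) :
    ∃ m : M, u = 1 ⊗ₜ m ∧ v = 1 ⊗ₜ m := by
  obtain ⟨m, rfl⟩ := P.exists_eq_one_tmul huv
  obtain ⟨n, rfl⟩ := P.symm.exists_eq_one_tmul huv.symm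
  obtain rfl : m = n := P.one_tmul_injective M (by simpa using huv)
  exact ⟨m, rfl, rfl⟩

include P in
lemma eq_zero_of_map_eq_map {x : Ω[B₀⁄A]} {y : Ω[B₁⁄A]}
    (hxy : map A A B₀ L x = map A A B₁ L y) : x = 0 := by
  let _ := P.e₀.toRingHom.toAlgebra
  let _ := P.e₁.toRingHom.toAlgebra
  let _ := (P.e.toRingHom.comp toLaurent).toAlgebra
  have : IsScalarTower A A[X] B₀ := .of_algebraMap_eq fun a => (P.e₀_C a).symm
  have : IsScalarTower A A[X] B₁ := .of_algebraMap_eq fun a => (P.e₁_C a).symm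
  have : IsScalarTower A A[X] L := .of_algebraMap_eq fun a => by
    change _ = P.e (toLaurent (Polynomial.C a))
    rw [← P.map_e₀, P.e₀_C, ← IsScalarTower.algebraMap_apply]
  have : Algebra.FormallyEtale A[X] L :=
    .of_equiv (AlgEquiv.ofRingEquiv (f := P.e) fun _ => rfl)
  obtain ⟨p, rfl⟩ := exists_smul_D_X_eq P.e₀.surjective x
  obtain ⟨q, rfl⟩ := exists_smul_D_X_eq P.e₁.surjective y
  have hp : map A A B₀ L (P.e₀ p • D A B₀ (P.e₀ X)) =
      P.e (toLaurent p) • D A L (P.e (T 1)) := by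
    rw [LinearMap.map_smul, map_D, ← algebraMap_smul L, P.map_e₀, P.map_e₀, toLaurent_X]
  have hq : map A A B₁ L (P.e₁ q • D A B₁ (P.e₁ X)) =
      -(P.e (invert (toLaurent (q * X ^ 2))) • D A L (P.e (T 1))) := by
    have hT : P.e (T (-1)) * P.e (T 1) = 1 := by rw [← map_mul, ← T_add]; simp
    rw [LinearMap.map_smul, map_D, ← algebraMap_smul L, P.map_e₁, P.map_e₁, toLaurent_X, invert_T,
      Derivation.leibniz_of_mul_eq_one _ hT]
    simp [smul_smul, ← map_pow, T_pow]
  have hsum : toLaurent p + invert (toLaurent (q * X ^ 2)) = 0 := by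
    refine P.e.map_eq_zero_iff.mp (eq_zero_of_smul_D_X_eq_zero (A := A) ?_)
    change _ • D A L (P.e (toLaurent X)) = 0
    rw [map_add, add_smul, toLaurent_X, add_eq_zero_iff_eq_neg]
    exact hp.symm.trans (hxy.trans hq)
  have hp0 : p = 0 := by
    simpa [truncLinear_toLaurent, truncLinear_invert_toLaurent, -map_mul, -map_pow]
      using congr(truncLinear $hsum)
  simp [hp0]

variable (k : Type*) [CommRing k] [Algebra k A] [Algebra k B₀] [Algebra k B₁] [Algebra k L]
  [IsScalarTower k A B₀] [IsScalarTower k A B₁] [IsScalarTower k A L] [IsScalarTower k B₀ L]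
  [IsScalarTower k B₁ L]

include P in
lemma exists_map_eq {x : Ω[B₀⁄k]} {y : Ω[B₁⁄k]} (hxy : map k k B₀ L x = map k k B₁ L y) :
    ∃ ω : Ω[A⁄k], map k k A B₀ ω = x ∧ map k k A B₁ ω = y := by
  have hrel : map A A B₀ L (map k A B₀ B₀ x) = map A A B₁ L (map k A B₁ B₁ y) := by
    rw [kaehler_map_map, kaehler_map_map, ← kaehler_map_map (B := L) k k A, hxy,
      kaehler_map_map]
  have hx := P.eq_zero_of_map_eq_map hrel
  have hy := P.symm.eq_zero_of_map_eq_map hrel.symm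
  obtain ⟨u, rfl⟩ := (exact_mapBaseChange_map k A B₀ x).mp hx
  obtain ⟨v, rfl⟩ := (exact_mapBaseChange_map k A B₁ y).mp hy
  have : Algebra.FormallySmooth A L := P.formallySmooth
  obtain ⟨ω, rfl, rfl⟩ := P.exists_eq_one_tmul_and (u := u) (v := v) (by
    apply mapBaseChange_injective k A L
    rw [mapBaseChange_rTensor, mapBaseChange_rTensor, hxy])
  exact ⟨ω, by simp, by simp⟩

end Algebra

end ProjectiveLineCoordinates

end Coordinates

section Sheafification

open Opposite

variable {X : Scheme.{u}} (P : X.PresheafOfModules)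

instance (U : X.Opens) : Module Γ(X, U) (P.obj (op U)) :=
  inferInstanceAs (Module (X.ringCatSheaf.obj.obj (op U)) (P.obj (op U)))

/-- The restriction of the sections of a presheaf of modules, as a semilinear map. -/
def presheafRes {U V : X.Opens} (h : V ≤ U) :
    P.obj (op U) →ₛₗ[(X.presheaf.map (homOfLE h).op).hom] P.obj (op V) where
  toFun := P.map (homOfLE h).op
  map_add' := map_add _
  map_smul' r m := P.map_smul (homOfLE h).op r m

lemma presheafRes_presheafRes {U V W : X.Opens} (h : V ≤ U) (h' : W ≤ V) (m : P.obj (op U)) :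
    presheafRes P h' (presheafRes P h m) = presheafRes P (h'.trans h) m :=
  congr($(P.presheaf.map_comp (homOfLE h).op (homOfLE h').op) m).symm

/-- The sheafification of a presheaf of modules. -/
abbrev sheafify : X.Modules :=
  (PresheafOfModules.sheafification (𝟙 X.ringCatSheaf.obj)).obj P

/-- The map from the sections of a presheaf of modules to those of its sheafification. -/
def toSheafifyOn (U : X.Opens) : P.obj (op U) →ₗ[Γ(X, U)] Γ(sheafify P, U) where
  toFun := ((PresheafOfModules.sheafificationAdjunction (𝟙 X.ringCatSheaf.obj)).unit.app P).app
    (op U)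
  map_add' := map_add _
  map_smul' r m := map_smul _ r m

variable {P}

lemma toSheafifyOn_presheafRes {U V : X.Opens} (h : V ≤ U) (m : P.obj (op U)) :
    toSheafifyOn P V (presheafRes P h m) = res (sheafify P) h (toSheafifyOn P U m) :=
  PresheafOfModules.naturality_apply
    ((PresheafOfModules.sheafificationAdjunction (𝟙 X.ringCatSheaf.obj)).unit.app P)
    (homOfLE h).op m

lemma exists_presheafRes_eq_zero {U : X.Opens} {m : P.obj (op U)} (hm : toSheafifyOn P U m = 0)
    {p : X} (hp : p ∈ U) : ∃ (V : X.Opens) (h : V ≤ U), p ∈ V ∧ presheafRes P h m = 0 := by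
  obtain ⟨V, i, hi, hpV⟩ := Presheaf.equalizerSieve_mem (Opens.grothendieckTopology X)
    (CategoryTheory.toSheafify (Opens.grothendieckTopology X) P.presheaf)
    (X := op U) m 0 (hm.trans (map_zero (toSheafifyOn P U)).symm) p hp
  exact ⟨V, leOfHom i, hpV, hi.trans (map_zero (presheafRes P (leOfHom i)))⟩

lemma exists_toSheafifyOn_eq_res {U : X.Opens} (s : Γ(sheafify P, U)) {p : X} (hp : p ∈ U) :
    ∃ (V : X.Opens) (h : V ≤ U) (m : P.obj (op V)), p ∈ V ∧
      toSheafifyOn P V m = res (sheafify P) h s := by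
  obtain ⟨V, i, ⟨m, hm⟩, hpV⟩ := Presheaf.imageSieve_mem (Opens.grothendieckTopology X)
    (CategoryTheory.toSheafify (Opens.grothendieckTopology X) P.presheaf) (U := op U) s p hp
  exact ⟨V, leOfHom i, m, hpV, hm⟩

variable (P) in
/-- The presheaf of modules `P` localizes on affine opens: for `V` affine and `f ∈ 𝒪(V)`, the
restriction `P(V) → P(D(f))` is a localization at `f`. The condition is spelled out elementwise
since the restriction is semilinear. -/
structure LocalizesOnAffines : Prop where
  exists_pow_smul_eq_zero {V : X.Opens} (hV : IsAffineOpen V) (f : Γ(X, V)) (m : P.obj (op V))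
    (hm : presheafRes P (X.basicOpen_le f) m = 0) : ∃ n : ℕ, f ^ n • m = 0
  exists_presheafRes_eq_pow_smul {V : X.Opens} (hV : IsAffineOpen V) (f : Γ(X, V))
    (m : P.obj (op (X.basicOpen f))) : ∃ (n : ℕ) (m' : P.obj (op V)),
      presheafRes P (X.basicOpen_le f) m' =
        X.presheaf.map (homOfLE (X.basicOpen_le f)).op f ^ n • m

lemma mem_of_forall_exists_pow_smul_mem {V : X.Opens} (hV : IsAffineOpen V) {M : Type*}
    [AddCommGroup M] [Module Γ(X, V) M] (N : Submodule Γ(X, V) M) (m : M)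
    (h : ∀ p ∈ V, ∃ f : Γ(X, V), p ∈ X.basicOpen f ∧ ∃ n : ℕ, f ^ n • m ∈ N) : m ∈ N := by
  have hI : N.comap (LinearMap.toSpanSingleton Γ(X, V) M m) = ⊤ := by
    rw [← Ideal.radical_eq_top]
    let I : Ideal Γ(X, V) := N.comap (LinearMap.toSpanSingleton Γ(X, V) M m)
    change I.radical = ⊤
    rw [← Ideal.span_eq I.radical, ← hV.self_le_iSup_basicOpen_iff]
    intro p hp
    obtain ⟨f, hpf, n, hn⟩ := h p hp
    exact Opens.mem_iSup.mpr ⟨⟨f, n, hn⟩, hpf⟩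
  simpa using hI.ge (Submodule.mem_top (x := (1 : Γ(X, V))))

lemma eq_zero_of_locally_res_eq_zero (M : X.Modules) {V : X.Opens} (s : Γ(M, V))
    (h : ∀ p ∈ V, ∃ (W : X.Opens) (hW : W ≤ V), p ∈ W ∧ res M hW s = 0) : s = 0 := by
  choose W hW hpW hs using fun p : V => h p p.2
  exact TopCat.Sheaf.eq_of_locally_eq' (⟨M.presheaf, M.isSheaf⟩ : TopCat.Sheaf Ab X) W V
    (fun p => homOfLE (hW p)) (fun p hp => Opens.mem_iSup.mpr ⟨⟨p, hp⟩, hpW _⟩) s 0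
    fun p => (hs p).trans (map_zero (res M (hW p))).symm

lemma exists_basicOpen_toSheafifyOn_eq_res {V : X.Opens} (hV : IsAffineOpen V)
    (s : Γ(sheafify P, V)) {p : X} (hp : p ∈ V) :
    ∃ (f : Γ(X, V)) (m : P.obj (op (X.basicOpen f))), p ∈ X.basicOpen f ∧
      toSheafifyOn P _ m = res (sheafify P) (X.basicOpen_le f) s := by
  obtain ⟨W, hW, m, hpW, hm⟩ := exists_toSheafifyOn_eq_res s hp
  obtain ⟨f, hfW, hpf⟩ := hV.exists_basicOpen_le ⟨p, hpW⟩ hp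
  exact ⟨f, presheafRes P hfW m, hpf, by rw [toSheafifyOn_presheafRes, hm, res_res]⟩

namespace LocalizesOnAffines

variable (hP : LocalizesOnAffines P) {V : X.Opens} (hV : IsAffineOpen V)
include hP hV

lemma toSheafifyOn_injective : Function.Injective (toSheafifyOn P V) := by
  rw [injective_iff_map_eq_zero]
  intro m hm
  refine mem_of_forall_exists_pow_smul_mem hV ⊥ m fun p hp => ?_
  obtain ⟨W, hW, hpW, hmW⟩ := exists_presheafRes_eq_zero hm hp
  obtain ⟨f, hfW, hpf⟩ := hV.exists_basicOpen_le ⟨p, hpW⟩ hp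
  exact ⟨f, hpf, hP.exists_pow_smul_eq_zero hV f m
    (by rw [← presheafRes_presheafRes P hW hfW, hmW, map_zero])⟩

lemma exists_pow_smul_sheafify_eq_zero_near (g : Γ(X, V)) (s : Γ(sheafify P, V))
    (hs : res (sheafify P) (X.basicOpen_le g) s = 0) {p : X} (hp : p ∈ V) :
    ∃ (W : X.Opens) (hW : W ≤ V) (n : ℕ), p ∈ W ∧ res (sheafify P) hW (g ^ n • s) = 0 := by
  obtain ⟨f, m, hpf, hm⟩ := exists_basicOpen_toSheafifyOn_eq_res hV s hp
  let g' : Γ(X, X.basicOpen f) := X.presheaf.map (homOfLE (X.basicOpen_le f)).op g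
  have hg' : X.basicOpen g' ≤ X.basicOpen g := by
    rw [X.basicOpen_res]; exact inf_le_right
  obtain ⟨n, hn⟩ := hP.exists_pow_smul_eq_zero (hV.basicOpen f) g' m (by
    apply hP.toSheafifyOn_injective ((hV.basicOpen f).basicOpen g')
    rw [toSheafifyOn_presheafRes, hm, res_res, ← res_res _ (X.basicOpen_le g) hg', hs, map_zero,
      map_zero])
  refine ⟨X.basicOpen f, X.basicOpen_le f, n, hpf, ?_⟩
  rw [map_smulₛₗ, ← hm, map_pow]
  exact (map_smul (toSheafifyOn P _) (g' ^ n) m).symm.trans (by rw [hn, map_zero])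

lemma exists_pow_smul_sheafify_eq_zero (g : Γ(X, V)) (s : Γ(sheafify P, V))
    (hs : res (sheafify P) (X.basicOpen_le g) s = 0) : ∃ n : ℕ, g ^ n • s = 0 := by
  choose! W hW n hpW hn using
    fun p hp => hP.exists_pow_smul_sheafify_eq_zero_near hV g s hs (p := p) hp
  obtain ⟨t, htV, ht⟩ := hV.isCompact.elim_nhds_subcover (fun p => (W p : Set X))
    fun p hp => (W p).isOpen.mem_nhds (hpW p hp)
  refine ⟨t.sup n, eq_zero_of_locally_res_eq_zero _ _ fun q hq => ?_⟩
  obtain ⟨p, hpt, hqp⟩ := Set.mem_iUnion₂.mp (ht hq)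
  refine ⟨W p, hW p (htV p hpt), hqp, ?_⟩
  rw [← Nat.sub_add_cancel (Finset.le_sup hpt), pow_add, mul_smul, map_smulₛₗ,
    hn p (htV p hpt), smul_zero]

theorem toSheafifyOn_bijective : Function.Bijective (toSheafifyOn P V) := by
  refine ⟨hP.toSheafifyOn_injective hV, fun s => ?_⟩
  refine mem_of_forall_exists_pow_smul_mem hV (LinearMap.range (toSheafifyOn P V)) s
    fun p hp => ?_
  obtain ⟨f, m, hpf, hm⟩ := exists_basicOpen_toSheafifyOn_eq_res hV s hp
  obtain ⟨n, m', hm'⟩ := hP.exists_presheafRes_eq_pow_smul hV f m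
  have hres : res (sheafify P) (X.basicOpen_le f) (toSheafifyOn P V m') =
      res (sheafify P) (X.basicOpen_le f) (f ^ n • s) := by
    rw [← toSheafifyOn_presheafRes, hm', map_smulₛₗ (res _ _), map_pow, ← hm]
    exact (toSheafifyOn P _).map_smul _ _
  obtain ⟨l, hl⟩ := hP.exists_pow_smul_sheafify_eq_zero hV f (f ^ n • s - toSheafifyOn P V m')
    (by rw [map_sub, hres, sub_self])
  refine ⟨f, hpf, l + n, f ^ l • m', ?_⟩
  rw [smul_sub, sub_eq_zero] at hl
  exact ((toSheafifyOn P V).map_smul _ _).trans (by rw [← hl, pow_add, mul_smul])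

end LocalizesOnAffines

end Sheafification

section KaehlerMap

variable {A R S : CommRingCat.{u}} {i : A ⟶ R} {j : A ⟶ S}

/-- The semilinear map on modules of differentials over `A` induced by a morphism `φ : R ⟶ S` of
`A`-algebras. -/
def kaehlerMap (φ : R ⟶ S) (h : i ≫ φ = j) :
    CommRingCat.KaehlerDifferential i →ₛₗ[φ.hom] CommRingCat.KaehlerDifferential j where
  toFun := CommRingCat.KaehlerDifferential.map (g := 𝟙 A) ((Category.id_comp j).trans h.symm)
  map_add' := map_add _
  map_smul' := map_smul
    (CommRingCat.KaehlerDifferential.map (g := 𝟙 A) ((Category.id_comp j).trans h.symm)).hom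

lemma kaehlerMap_d (φ : R ⟶ S) (h : i ≫ φ = j) (r : R) :
    kaehlerMap φ h (CommRingCat.KaehlerDifferential.d r) =
      CommRingCat.KaehlerDifferential.d (φ r) :=
  CommRingCat.KaehlerDifferential.map_d ((Category.id_comp j).trans h.symm) r

@[elab_as_elim]
lemma kaehler_induction {P : CommRingCat.KaehlerDifferential i → Prop}
    (d : ∀ r : R, P (CommRingCat.KaehlerDifferential.d r)) (zero : P 0)
    (add : ∀ x y, P x → P y → P (x + y)) (smul : ∀ (r : R) x, P x → P (r • x))
    (x : CommRingCat.KaehlerDifferential i) : P x := by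
  let _ := i.hom.toAlgebra
  have hx : x ∈ Submodule.span R (Set.range (KaehlerDifferential.D A R)) := by
    rw [KaehlerDifferential.span_range_derivation]; trivial
  induction hx using Submodule.span_induction with
  | mem z hz => obtain ⟨r, rfl⟩ := hz; exact d r
  | zero => exact zero
  | add x y _ _ hx hy => exact add x y hx hy
  | smul r x _ hx => exact smul r x hx

lemma exists_pow_smul_eq_zero_of_kaehlerMap_eq_zero {φ : R ⟶ S} (h : i ≫ φ = j) {f : R}
    (hf : letI := φ.hom.toAlgebra; IsLocalization.Away f S)
    {x : CommRingCat.KaehlerDifferential i} (hx : kaehlerMap φ h x = 0) :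
    ∃ n : ℕ, f ^ n • x = 0 := by
  let _ := i.hom.toAlgebra
  let _ := j.hom.toAlgebra
  let _ := φ.hom.toAlgebra
  have : IsScalarTower A R S := .of_algebraMap_eq' congr(($h).hom).symm
  have : IsLocalization (.powers f) S := hf
  obtain ⟨⟨_, n, rfl⟩, hn⟩ := (IsLocalizedModule.eq_zero_iff (.powers f)
    (KaehlerDifferential.map A A R S)).mp hx
  exact ⟨n, hn⟩

lemma exists_kaehlerMap_eq_pow_smul {φ : R ⟶ S} (h : i ≫ φ = j) (f : R)
    (hf : letI := φ.hom.toAlgebra; IsLocalization.Away f S)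
    (x : CommRingCat.KaehlerDifferential j) :
    ∃ (n : ℕ) (y : CommRingCat.KaehlerDifferential i), kaehlerMap φ h y = φ f ^ n • x := by
  let _ := i.hom.toAlgebra
  let _ := j.hom.toAlgebra
  let _ := φ.hom.toAlgebra
  have : IsScalarTower A R S := .of_algebraMap_eq' congr(($h).hom).symm
  have : IsLocalization (.powers f) S := hf
  obtain ⟨⟨y, ⟨_, n, rfl⟩⟩, hn⟩ := IsLocalizedModule.surj (.powers f)
    (KaehlerDifferential.map A A R S) x
  refine ⟨n, y, hn.symm.trans ?_⟩
  rw [← map_pow]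
  exact (algebraMap_smul (M := KaehlerDifferential A S) S (f ^ n) x).symm

namespace ProjectiveLineCoordinates

variable {B₀ B₁ L : CommRingCat.{u}} {i₀ : A ⟶ B₀} {i₁ : A ⟶ B₁} {l : A ⟶ L}
  {φ₀ : R ⟶ B₀} {φ₁ : R ⟶ B₁} {ψ₀ : B₀ ⟶ L} {ψ₁ : B₁ ⟶ L}

lemma kaehlerMap_injective (P : ProjectiveLineCoordinates φ₀.hom φ₁.hom ψ₀.hom ψ₁.hom)
    (h₀ : i ≫ φ₀ = i₀) : Function.Injective (kaehlerMap φ₀ h₀) := by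
  subst h₀
  let _ := i.hom.toAlgebra
  let _ := φ₀.hom.toAlgebra
  let _ := φ₁.hom.toAlgebra
  let _ := ψ₀.hom.toAlgebra
  let _ := ψ₁.hom.toAlgebra
  let _ := (i ≫ φ₀).hom.toAlgebra
  let _ := (φ₀ ≫ ψ₀).hom.toAlgebra
  let _ := (i ≫ φ₀ ≫ ψ₀).hom.toAlgebra
  have : IsScalarTower A R B₀ := .of_algebraMap_eq' rfl
  have : IsScalarTower A R L := .of_algebraMap_eq' rfl
  have : IsScalarTower A B₀ L := .of_algebraMap_eq' rfl
  have : IsScalarTower R B₀ L := .of_algebraMap_eq' rfl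
  exact map_injective P A

lemma exists_kaehlerMap_eq (P : ProjectiveLineCoordinates φ₀.hom φ₁.hom ψ₀.hom ψ₁.hom)
    (h₀ : i ≫ φ₀ = i₀) (h₁ : i ≫ φ₁ = i₁) (hψ₀ : i₀ ≫ ψ₀ = l) (hψ₁ : i₁ ≫ ψ₁ = l)
    (hψ : φ₀ ≫ ψ₀ = φ₁ ≫ ψ₁) {x : CommRingCat.KaehlerDifferential i₀}
    {y : CommRingCat.KaehlerDifferential i₁} (hxy : kaehlerMap ψ₀ hψ₀ x = kaehlerMap ψ₁ hψ₁ y) :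
    ∃ ω : CommRingCat.KaehlerDifferential i, kaehlerMap φ₀ h₀ ω = x ∧ kaehlerMap φ₁ h₁ ω = y := by
  let _ := i.hom.toAlgebra
  let _ := i₀.hom.toAlgebra
  let _ := i₁.hom.toAlgebra
  let _ := l.hom.toAlgebra
  let _ := φ₀.hom.toAlgebra
  let _ := φ₁.hom.toAlgebra
  let _ := ψ₀.hom.toAlgebra
  let _ := ψ₁.hom.toAlgebra
  let _ := (φ₀ ≫ ψ₀).hom.toAlgebra
  have : IsScalarTower A R B₀ := .of_algebraMap_eq' congr(($h₀).hom).symm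
  have : IsScalarTower A R B₁ := .of_algebraMap_eq' congr(($h₁).hom).symm
  have : IsScalarTower A B₀ L := .of_algebraMap_eq' congr(($hψ₀).hom).symm
  have : IsScalarTower A B₁ L := .of_algebraMap_eq' congr(($hψ₁).hom).symm
  have : IsScalarTower R B₀ L := .of_algebraMap_eq' rfl
  have : IsScalarTower R B₁ L := .of_algebraMap_eq' congr(($hψ).hom)
  have : IsScalarTower A R L := .of_algebraMap_eq' (by
    rw [← hψ₀, ← h₀]; rfl : l.hom = (φ₀ ≫ ψ₀).hom.comp i.hom)
  exact exists_map_eq P A hxy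

end ProjectiveLineCoordinates

end KaehlerMap

section Affine

open Opposite

variable {k : Type u} [Field k] {X : Scheme.{u}} (x : X ⟶ Spec (.of k))

lemma constToPresheaf_app_map {V W : X.Opens} (h : W ≤ V) :
    (constToPresheaf x).app (op V) ≫ X.presheaf.map (homOfLE h).op =
      (constToPresheaf x).app (op W) :=
  ((constToPresheaf x).naturality (homOfLE h).op).symm.trans (Category.id_comp _)

lemma isLocalization_away_res {V W : X.Opens} (hV : IsAffineOpen V) (f : Γ(X, V)) (h : W ≤ V)
    (hW : W = X.basicOpen f) :
    letI := (X.presheaf.map (homOfLE h).op).hom.toAlgebra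
    IsLocalization.Away f Γ(X, W) :=
  hV.isLocalization_of_eq_basicOpen f (homOfLE h) hW

theorem localizesOnAffines_presheafOmega : LocalizesOnAffines (presheafOmega x) where
  exists_pow_smul_eq_zero hV f _ hm := exists_pow_smul_eq_zero_of_kaehlerMap_eq_zero
    (constToPresheaf_app_map x (X.basicOpen_le f)) (isLocalization_away_res hV f _ rfl) hm
  exists_presheafRes_eq_pow_smul hV f m := exists_kaehlerMap_eq_pow_smul
    (constToPresheaf_app_map x (X.basicOpen_le f)) f (isLocalization_away_res hV f _ rfl) m

/-- The map from the differentials of `𝒪(V)` to the sections of the cotangent sheaf over `V`. -/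
def toOmegaOn (V : X.Opens) :
    CommRingCat.KaehlerDifferential ((constToPresheaf x).app (op V)) →ₗ[Γ(X, V)] Γ(Omega x, V) :=
  toSheafifyOn (presheafOmega x) V

lemma toOmegaOn_d (V : X.Opens) (f : Γ(X, V)) :
    toOmegaOn x V (CommRingCat.KaehlerDifferential.d f) = omegaDOn x V f := rfl

lemma toOmegaOn_kaehlerMap {V W : X.Opens} (h : W ≤ V)
    (ω : CommRingCat.KaehlerDifferential ((constToPresheaf x).app (op V))) :
    toOmegaOn x W (kaehlerMap (X.presheaf.map (homOfLE h).op) (constToPresheaf_app_map x h) ω) =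
      res (Omega x) h (toOmegaOn x V ω) :=
  toSheafifyOn_presheafRes (P := presheafOmega x) h ω

theorem toOmegaOn_bijective {V : X.Opens} (hV : IsAffineOpen V) :
    Function.Bijective (toOmegaOn x V) :=
  (localizesOnAffines_presheafOmega x).toSheafifyOn_bijective hV

end Affine

section Eta

open Opposite

variable {k : Type u} [Field k] {X C : Scheme.{u}} (π : X ⟶ C) (c : C ⟶ Spec (.of k))

lemma constToPresheaf_app_appLE {U : C.Opens} {V : X.Opens} (h : V ≤ π ⁻¹ᵁ U) :
    (constToPresheaf c).app (op U) ≫ π.appLE U V h = (constToPresheaf (π ≫ c)).app (op V) := by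
  rw [← constToPresheaf_app_map (π ≫ c) h, ← constToPresheaf_app π c U, Category.assoc]
  rfl

/-- The natural map `η` on sections over `U`. -/
def etaOn (U : C.Opens) :
    Γ(Omega c, U) →ₛₗ[(π.app U).hom] Γ(Omega (π ≫ c), π ⁻¹ᵁ U) where
  toFun := (eta π c).app U
  map_add' := ((eta π c).app U).hom.map_add
  map_smul' := (eta π c).app_smul

lemma res_etaOn_toOmegaOn {U : C.Opens} {V : X.Opens} (h : V ≤ π ⁻¹ᵁ U)
    (ω : CommRingCat.KaehlerDifferential ((constToPresheaf c).app (op U))) :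
    res (Omega (π ≫ c)) h (etaOn π c U (toOmegaOn c U ω)) =
      toOmegaOn (π ≫ c) V (kaehlerMap (π.appLE U V h) (constToPresheaf_app_appLE π c h) ω) := by
  induction ω using kaehler_induction with
  | d f =>
    rw [kaehlerMap_d, toOmegaOn_d, toOmegaOn_d]
    exact (congrArg (res (Omega (π ≫ c)) h) (eta_omegaDOn π c U f)).trans
      (omegaDOn_map (π ≫ c) (homOfLE h) _).symm
  | zero => simp only [map_zero]
  | add x y hx hy => simp only [map_add, hx, hy]
  | smul f x hx =>
    have hsmul := (kaehlerMap (π.appLE U V h) (constToPresheaf_app_appLE π c h)).map_smulₛₗ f x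
    rw [(toOmegaOn c U).map_smul, map_smulₛₗ, map_smulₛₗ, hx]
    exact ((congrArg (toOmegaOn (π ≫ c) V) hsmul).trans ((toOmegaOn (π ≫ c) V).map_smul _ _)).symm

theorem etaOn_bijective_of_coordinates {U : C.Opens} (hU : IsAffineOpen U) {V₀ V₁ W : X.Opens}
    (hV₀ : IsAffineOpen V₀) (hV₁ : IsAffineOpen V₁) (hW : IsAffineOpen W) (h₀ : V₀ ≤ π ⁻¹ᵁ U)
    (h₁ : V₁ ≤ π ⁻¹ᵁ U) (hW₀ : W ≤ V₀) (hW₁ : W ≤ V₁) (hcov : π ⁻¹ᵁ U ≤ V₀ ⊔ V₁)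
    (P : ProjectiveLineCoordinates (π.appLE U V₀ h₀).hom (π.appLE U V₁ h₁).hom
      (X.presheaf.map (homOfLE hW₀).op).hom (X.presheaf.map (homOfLE hW₁).op).hom) :
    Function.Bijective (etaOn π c U) := by
  constructor
  · rw [injective_iff_map_eq_zero]
    intro a ha
    obtain ⟨ω, rfl⟩ := (toOmegaOn_bijective c hU).2 a
    have h : toOmegaOn (π ≫ c) V₀
        (kaehlerMap _ (constToPresheaf_app_appLE π c h₀) ω) = 0 := by
      rw [← res_etaOn_toOmegaOn, ha, map_zero]
    rw [map_eq_zero_iff _ (toOmegaOn_bijective (π ≫ c) hV₀).1,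
      map_eq_zero_iff _ (P.kaehlerMap_injective _)] at h
    rw [h, map_zero]
  · intro a
    obtain ⟨x, hx⟩ := (toOmegaOn_bijective (π ≫ c) hV₀).2 (res (Omega (π ≫ c)) h₀ a)
    obtain ⟨y, hy⟩ := (toOmegaOn_bijective (π ≫ c) hV₁).2 (res (Omega (π ≫ c)) h₁ a)
    have hxy : kaehlerMap _ (constToPresheaf_app_map (π ≫ c) hW₀) x =
        kaehlerMap _ (constToPresheaf_app_map (π ≫ c) hW₁) y := by
      apply (toOmegaOn_bijective (π ≫ c) hW).1
      rw [toOmegaOn_kaehlerMap, toOmegaOn_kaehlerMap, hx, hy, res_res, res_res]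
    obtain ⟨ω, rfl, rfl⟩ := P.exists_kaehlerMap_eq (constToPresheaf_app_appLE π c h₀)
      (constToPresheaf_app_appLE π c h₁) _ _
      (by rw [Scheme.Hom.appLE_map, Scheme.Hom.appLE_map]) hxy
    refine ⟨toOmegaOn c U ω, sub_eq_zero.mp ?_⟩
    refine eq_zero_of_locally_res_eq_zero (Omega (π ≫ c)) (V := π ⁻¹ᵁ U) _ fun p hp => ?_
    rcases hcov hp with hp | hp
    · exact ⟨V₀, h₀, hp, by rw [map_sub, res_etaOn_toOmegaOn, hx, sub_self]⟩
    · exact ⟨V₁, h₁, hp, by rw [map_sub, res_etaOn_toOmegaOn, hy, sub_self]⟩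

lemma isIso_eta_of_isBasis {ι : Type u} {B : ι → C.Opens} (hB : Opens.IsBasis (Set.range B))
    (h : ∀ i, Function.Bijective (etaOn π c (B i))) : IsIso (eta π c) := by
  rw [← isIso_iff_of_reflects_iso _ (Scheme.Modules.toPresheaf C)]
  let η : (⟨(Omega c).presheaf, (Omega c).isSheaf⟩ : TopCat.Sheaf Ab C) ⟶
      ⟨((Scheme.Modules.pushforward π).obj (Omega (π ≫ c))).presheaf,
        ((Scheme.Modules.pushforward π).obj (Omega (π ≫ c))).isSheaf⟩ :=
    ⟨(eta π c).mapPresheaf⟩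
  have : IsIso η := TopCat.Sheaf.isIso_iff_isIso_basis hB fun i =>
    (ConcreteCategory.isIso_iff_bijective _).mpr (h i)
  exact inferInstanceAs (IsIso ((sheafToPresheaf _ _).map η))

end Eta

section Charts

variable {X : Scheme.{u}} {B L : CommRingCat.{u}}

lemma range_eq_range_fromSpec (f : Spec B ⟶ X) [IsOpenImmersion f] :
    Set.range f = Set.range (isAffineOpen_opensRange f).fromSpec := by
  rw [IsAffineOpen.range_fromSpec, Scheme.Hom.coe_opensRange]

/-- The ring of functions on the image of a chart `f : Spec B ⟶ X`, identified with `B`. -/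
def chartIso (f : Spec B ⟶ X) [IsOpenImmersion f] : Γ(X, f.opensRange) ≅ B :=
  (Scheme.Spec.preimageIso (X := .op B) (Y := .op Γ(X, f.opensRange))
    (IsOpenImmersion.isoOfRangeEq f (isAffineOpen_opensRange f).fromSpec
      (range_eq_range_fromSpec f))).unop

lemma SpecMap_chartIso_hom_fromSpec (f : Spec B ⟶ X) [IsOpenImmersion f] :
    Spec.map (chartIso f).hom ≫ (isAffineOpen_opensRange f).fromSpec = f := by
  have h : Spec.map (chartIso f).hom = (IsOpenImmersion.isoOfRangeEq f
      (isAffineOpen_opensRange f).fromSpec (range_eq_range_fromSpec f)).hom :=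
    Scheme.Spec.map_preimage _
  rw [h, IsOpenImmersion.isoOfRangeEq_hom_fac]

lemma opensRange_le_opensRange {f : Spec B ⟶ X} [IsOpenImmersion f] {g : Spec L ⟶ X}
    [IsOpenImmersion g] {ψ : B ⟶ L} (h : Spec.map ψ ≫ f = g) : g.opensRange ≤ f.opensRange := by
  rintro _ ⟨x, rfl⟩
  exact ⟨Spec.map ψ x, by rw [← h, Scheme.Hom.comp_apply]⟩

lemma chartIso_inv_presheaf_map {f : Spec B ⟶ X} [IsOpenImmersion f] {g : Spec L ⟶ X}
    [IsOpenImmersion g] {ψ : B ⟶ L} (h : Spec.map ψ ≫ f = g) :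
    (chartIso f).inv ≫ X.presheaf.map (homOfLE (opensRange_le_opensRange h)).op =
      ψ ≫ (chartIso g).inv := by
  rw [Iso.inv_comp_eq, ← Category.assoc, Iso.eq_comp_inv]
  apply Spec.map_injective
  rw [← cancel_mono (isAffineOpen_opensRange f).fromSpec, Spec.map_comp, Spec.map_comp,
    Category.assoc, Category.assoc, IsAffineOpen.map_fromSpec _ (isAffineOpen_opensRange g),
    SpecMap_chartIso_hom_fromSpec, SpecMap_chartIso_hom_fromSpec, h]

variable {C : Scheme.{u}} (π : X ⟶ C)

lemma comp_chartIso_inv {f : Spec B ⟶ X} [IsOpenImmersion f] {U : C.Opens}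
    (hU : IsAffineOpen U) (hf : f.opensRange ≤ π ⁻¹ᵁ U) {φ : Γ(C, U) ⟶ B}
    (h : f ≫ π = Spec.map φ ≫ hU.fromSpec) :
    φ ≫ (chartIso f).inv = π.appLE U f.opensRange hf := by
  rw [Iso.comp_inv_eq]
  apply Spec.map_injective
  rw [← cancel_mono hU.fromSpec, Spec.map_comp, Category.assoc,
    IsAffineOpen.SpecMap_appLE_fromSpec _ _ (isAffineOpen_opensRange f), ← Category.assoc,
    SpecMap_chartIso_hom_fromSpec, h]

variable {k : Type u} [Field k] (c : C ⟶ Spec (.of k)) {B₀ B₁ : CommRingCat.{u}}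

theorem etaOn_bijective_of_charts {U : C.Opens} (hU : IsAffineOpen U) {j₀ : Spec B₀ ⟶ X}
    {j₁ : Spec B₁ ⟶ X} {j : Spec L ⟶ X} [IsOpenImmersion j₀] [IsOpenImmersion j₁]
    [IsOpenImmersion j] {φ₀ : Γ(C, U) ⟶ B₀} {φ₁ : Γ(C, U) ⟶ B₁} {ψ₀ : B₀ ⟶ L} {ψ₁ : B₁ ⟶ L}
    (hφ₀ : j₀ ≫ π = Spec.map φ₀ ≫ hU.fromSpec) (hφ₁ : j₁ ≫ π = Spec.map φ₁ ≫ hU.fromSpec)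
    (hψ₀ : Spec.map ψ₀ ≫ j₀ = j) (hψ₁ : Spec.map ψ₁ ≫ j₁ = j)
    (hcov : j₀.opensRange ⊔ j₁.opensRange = π ⁻¹ᵁ U)
    (P : ProjectiveLineCoordinates φ₀.hom φ₁.hom ψ₀.hom ψ₁.hom) :
    Function.Bijective (etaOn π c U) := by
  have h₀ : j₀.opensRange ≤ π ⁻¹ᵁ U := le_sup_left.trans hcov.le
  have h₁ : j₁.opensRange ≤ π ⁻¹ᵁ U := le_sup_right.trans hcov.le
  refine etaOn_bijective_of_coordinates π c hU (isAffineOpen_opensRange j₀)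
    (isAffineOpen_opensRange j₁) (isAffineOpen_opensRange j) h₀ h₁
    (opensRange_le_opensRange hψ₀) (opensRange_le_opensRange hψ₁) hcov.ge
    (P.congr (chartIso j₀).symm.commRingCatIsoToRingEquiv
      (chartIso j₁).symm.commRingCatIsoToRingEquiv (chartIso j).symm.commRingCatIsoToRingEquiv
      ?_ ?_ ?_ ?_)
  · exact ConcreteCategory.congr_hom (comp_chartIso_inv π hU h₀ hφ₀)
  · exact ConcreteCategory.congr_hom (comp_chartIso_inv π hU h₁ hφ₁)
  · exact ConcreteCategory.congr_hom (chartIso_inv_presheaf_map hψ₀)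
  · exact ConcreteCategory.congr_hom (chartIso_inv_presheaf_map hψ₁)

end Charts

section Proj

open HomogeneousLocalization

variable {R M : Type u} [CommRing R] [AddCommGroup M] [Module R M] (b : Module.Basis (Fin 2) R M)

/-- The ratio `x_j / x_i` on the chart of `Proj (Sym M)` where `x_i` does not vanish. -/
def ratio (i j : Fin 2) : Away (symGrading R M) (SymmetricAlgebra.ι R M (b i)) :=
  Away.isLocalizationElem (ι_mem_symGrading (b i)) (ι_mem_symGrading (b j))

lemma bijective_eval₂_ratio {i j : Fin 2} (hij : j ≠ i) :
    Function.Bijective (Polynomial.eval₂RingHom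
      (awayBase (SymmetricAlgebra.ι R M (b i))) (ratio b i j)) := by
  let _ : Unique {j // j ≠ i} := ⟨⟨⟨j, hij⟩⟩, fun l => Subtype.ext (by have := l.2; lia)⟩
  have h : (Polynomial.eval₂RingHom (awayBase (SymmetricAlgebra.ι R M (b i))) (ratio b i j)).comp
      (MvPolynomial.uniqueAlgEquiv R {j // j ≠ i}).toRingEquiv.toRingHom =
      polyToAway b i _ rfl := by
    apply MvPolynomial.ringHom_ext
    · intro r
      have hr : MvPolynomial.uniqueAlgEquiv R {j // j ≠ i} (MvPolynomial.C r) = Polynomial.C r :=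
        AlgEquiv.commutes _ r
      simp [polyToAway, hr]
    · intro l
      obtain rfl : l = ⟨j, hij⟩ := Subsingleton.elim _ _
      have hl : MvPolynomial.uniqueAlgEquiv R {j // j ≠ i} (MvPolynomial.X ⟨j, hij⟩) =
        Polynomial.X := MvPolynomial.eval₂_X _ _ _
      simp [polyToAway, hl, ratio, Away.isLocalizationElem]
  have h' := polyToAway_bijective b i _ rfl
  rw [← h, RingHom.coe_comp] at h'
  exact (Function.Bijective.of_comp_iff _
    (MvPolynomial.uniqueAlgEquiv R {j // j ≠ i}).bijective).mp h'

lemma awayMap_ratio_mul (i j : Fin 2) {x : SymmetricAlgebra R M}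
    (hx : x = SymmetricAlgebra.ι R M (b i) * SymmetricAlgebra.ι R M (b j))
    (hx' : x = SymmetricAlgebra.ι R M (b j) * SymmetricAlgebra.ι R M (b i)) :
    awayMap (symGrading R M) (ι_mem_symGrading (b j)) hx (ratio b i j) *
      awayMap (symGrading R M) (ι_mem_symGrading (b i)) hx' (ratio b j i) = 1 := by
  apply val_injective
  simp only [ratio, awayMap_mk, val_mul, val_one, Away.val_mk, Localization.mk_mul]
  rw [← Localization.mk_one, Localization.mk_eq_mk_iff, Localization.r_iff_exists]
  refine ⟨1, ?_⟩
  simp only [OneMemClass.coe_one, one_mul, Submonoid.coe_mul, mul_one, hx]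
  ring

lemma awayMap_comp_awayBase {n : ℕ} {x y z : SymmetricAlgebra R M} (hy : y ∈ symGrading R M n)
    (hz : z = x * y) :
    (awayMap (symGrading R M) hy hz).comp (awayBase x) = awayBase z := by
  ext r
  exact congrArg val (awayMap_fromZeroRingHom (symGrading R M) hy hz _)

/-- The coordinates `x₁ / x₀` and `x₀ / x₁` on the standard charts of `Proj (Sym M)`, where `x₀`
and `x₁` are a basis of `M`. -/
def projCoordinates : ProjectiveLineCoordinates
    (awayBase (SymmetricAlgebra.ι R M (b 0))) (awayBase (SymmetricAlgebra.ι R M (b 1)))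
    (awayMap (symGrading R M) (ι_mem_symGrading (b 1)) rfl)
    (awayMap (symGrading R M) (ι_mem_symGrading (b 0)) (mul_comm _ _)) :=
  .ofIsLocalization (by rw [awayMap_comp_awayBase, awayMap_comp_awayBase]) (ratio b 0 1)
    (ratio b 1 0) (bijective_eval₂_ratio b (by simp)) (bijective_eval₂_ratio b (by simp))
    (Away.isLocalization_mul (ι_mem_symGrading (b 0)) (ι_mem_symGrading (b 1)) rfl one_ne_zero)
    (awayMap_ratio_mul b 0 1 _ _)

/-- The standard chart of `Proj (Sym M)` where `x_i` does not vanish. -/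
abbrev projChart (i : Fin 2) :
    Spec (.of (Away (symGrading R M) (SymmetricAlgebra.ι R M (b i)))) ⟶ Proj (symGrading R M) :=
  Proj.awayι (symGrading R M) _ (ι_mem_symGrading (b i)) one_pos

/-- The intersection of the two standard charts of `Proj (Sym M)`. -/
abbrev projOverlap : Spec (.of (Away (symGrading R M)
    (SymmetricAlgebra.ι R M (b 0) * SymmetricAlgebra.ι R M (b 1)))) ⟶ Proj (symGrading R M) :=
  Proj.awayι (symGrading R M) _
    (SetLike.mul_mem_graded (ι_mem_symGrading (b 0)) (ι_mem_symGrading (b 1))) two_pos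

lemma opensRange_projChart_comp_sup {X : Scheme.{u}} (j : Proj (symGrading R M) ⟶ X)
    [IsOpenImmersion j] :
    (projChart b 0 ≫ j).opensRange ⊔ (projChart b 1 ≫ j).opensRange = j.opensRange := by
  have h : ⨆ i, (projChart b i ≫ j).opensRange = j.opensRange := by
    simp only [Scheme.Hom.opensRange_comp, Proj.opensRange_awayι]
    rw [← Scheme.Hom.image_iSup, Proj.iSup_basicOpen_eq_top _ _ (irrelevant_le_span b b.span_eq),
      Scheme.Hom.image_top_eq_opensRange]
  refine le_antisymm (h ▸ sup_le (le_iSup_of_le 0 le_rfl) (le_iSup_of_le 1 le_rfl)) ?_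
  exact h ▸ iSup_le (Fin.forall_fin_two.mpr ⟨le_sup_left, le_sup_right⟩)

variable {k : Type u} [Field k] {X C : Scheme.{u}} (π : X ⟶ C) (c : C ⟶ Spec (.of k))

theorem etaOn_bijective_of_proj {U : C.Opens} (hU : IsAffineOpen U) {M : Type u} [AddCommGroup M]
    [Module Γ(C, U) M] (b : Module.Basis (Fin 2) Γ(C, U) M)
    (j : Proj (symGrading Γ(C, U) M) ⟶ X) [IsOpenImmersion j] (hj : j.opensRange = π ⁻¹ᵁ U)
    (hjπ : j ≫ π = projToSpec Γ(C, U) M ≫ hU.fromSpec) :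
    Function.Bijective (etaOn π c U) := by
  have hφ (i : Fin 2) : (projChart b i ≫ j) ≫ π =
      Spec.map (CommRingCat.ofHom (awayBase _)) ≫ hU.fromSpec := by
    rw [Category.assoc, hjπ, ← Category.assoc, awayι_projToSpec]
  have hψ₀ : Spec.map (CommRingCat.ofHom (awayMap (symGrading Γ(C, U) M)
      (ι_mem_symGrading (b 1)) rfl)) ≫ projChart b 0 ≫ j = projOverlap b ≫ j := by
    rw [← Category.assoc, Proj.SpecMap_awayMap_awayι]
  have hψ₁ : Spec.map (CommRingCat.ofHom (awayMap (symGrading Γ(C, U) M)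
      (ι_mem_symGrading (b 0)) (mul_comm _ _))) ≫ projChart b 1 ≫ j = projOverlap b ≫ j := by
    rw [← Category.assoc, Proj.SpecMap_awayMap_awayι]
  exact etaOn_bijective_of_charts π c hU (hφ 0) (hφ 1) hψ₀ hψ₁
    ((opensRange_projChart_comp_sup b j).trans hj) (projCoordinates b)

end Proj

section ProjBundle

variable {X C : Scheme.{u}} (E : C.Modules) [IsVectorBundle E 2]

/-- The chart `Proj (Sym E(U)) ⟶ ℙ(E)` over an affine open `U` on which `E` has a frame. -/
def bundleChart (U : FrameOpens E 2) :
    Proj (symGrading Γ(C, U.opens) Γ(E, U.opens)) ⟶ ProjBundle E 2 :=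
  colimit.ι (projGluingData E 2).functor U

instance (U : FrameOpens E 2) : IsOpenImmersion (bundleChart E U) :=
  (projGluingData E 2).cover.map_prop U

lemma opensRange_bundleChart (U : FrameOpens E 2) :
    (bundleChart E U).opensRange = ProjBundle.toBase E 2 ⁻¹ᵁ U.opens :=
  ((projGluingData E 2).toBase_preimage_eq_opensRange_ι U).symm.trans
    (congrArg (ProjBundle.toBase E 2 ⁻¹ᵁ ·) U.opens.opensRange_ι)

lemma bundleChart_toBase (U : FrameOpens E 2) : bundleChart E U ≫ ProjBundle.toBase E 2 =
    projToSpec Γ(C, U.opens) Γ(E, U.opens) ≫ U.isAffine.fromSpec :=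
  ((projGluingData E 2).ι_toBase U).trans (Category.assoc _ _ _)

variable {E} {k : Type u} [Field k] (c : C ⟶ Spec (.of k))

lemma IsRuledSurface.etaOn_bijective {π : X ⟶ C} (hπ : IsRuledSurface π E) (U : FrameOpens E 2) :
    Function.Bijective (etaOn π c U.opens) := by
  obtain ⟨e, rfl⟩ := hπ
  obtain ⟨s, hs⟩ := U.exists_frame
  refine etaOn_bijective_of_proj _ c U.isAffine (hs.basis le_rfl) (bundleChart E U ≫ e.inv) ?_ ?_
  · rw [Scheme.Hom.opensRange_comp, opensRange_bundleChart, Scheme.Hom.inv_image]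
    rfl
  · rw [Category.assoc, e.inv_hom_id_assoc, bundleChart_toBase]

end ProjBundle

end

end RuledSurface

theorem proposition3p4_general {k : Type u} [Field k] {C : Scheme.{u}} (c : C ⟶ Spec (.of k))
    (E : C.Modules) [RuledSurface.IsVectorBundle E 2] {X : Scheme.{u}} (π : X ⟶ C)
    (hπ : RuledSurface.IsRuledSurface π E) : IsIso (RuledSurface.eta π c) :=
  RuledSurface.isIso_eta_of_isBasis π c (RuledSurface.isBasis_frameOpens E 2)
    (hπ.etaOn_bijective c)

theorem proposition3p4 {k : Type u} [Field k] [IsAlgClosed k] [CharZero k]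
    {C : Scheme.{u}} (c : C ⟶ Spec (.of k)) (hC : RuledSurface.IsSmoothProjectiveCurve c)
    (E : C.Modules) [RuledSurface.IsVectorBundle E 2]
    {X : Scheme.{u}} (π : X ⟶ C) (hπ : RuledSurface.IsRuledSurface π E) :
    IsIso (RuledSurface.eta π c) :=
  proposition3p4_general c E π hπ
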